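/- **Setting.** Let $\Sigma=(A,G,\alpha,\sigma)$ be a twisted unital discrete $C^*$-dynamical system: $A$ is a unital $C^*$-algebra, $G$ is a discrete group with identity $e$, and $\alpha:G\to\mathrm{Aut}(A)$, $\sigma:G\times G\to\mathcal U(A)$ are maps such that, for all $g,h,k\in G$, $$\alpha_g\circ\alpha_h=\mathrm{Ad}(\sigma(g,h))\circ\alpha_{gh},\qquad \sigma(g,h)\,\sigma(gh,k)=\alpha_g(\sigma(h,k))\,\sigma(g,hk),\qquad \sigma(g,e)=\sigma(e,g)=1 .$$ Let $A$ act faithfully on a Hilbert space $\mathcal H$. The reduced crossed product $C_r^*(\Sigma)$ is the $C^*$-algebra of operators on $\ell^2(G,\mathcal H)$ generated by the operators $(\pi(a)\xi)(h)=\alpha_{h^{-1}}(a)\,\xi(h)$ for $a\in A$ and the unitaries $(\lambda(g)\xi)(h)=\sigma(h^{-1},g)\,\xi(g^{-1}h)$ for $g\in G$; up to canonical isomorphism it does not depend on $\mathcal H$. Identify $A$ with $\pi(A)$, and let $E:C_r^*(\Sigma)\to A$ be the canonical conditional expectation, so that $E(a)=a$ for $a\in A$ and $E(a\lambda(g))=0$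 for $a\in A$, $g\neq e$. "Ideal" means closed two-sided ideal. An ideal $J$ of $A$ is invariant if $\alpha_g(J)=J$ for all $g\in G$. In that case $\Sigma/J=(A/J,G,\dot\alpha,\dot\sigma)$ denotes the induced system, and $\langle J\rangle$ denotes the ideal of $C_r^*(\Sigma)$ generated by $J$. A maximal invariant ideal of $A$ is a maximal element among the proper invariant ideals of $A$. A maximal ideal of $C_r^*(\Sigma)$ is a maximal element among its proper ideals. A $C^*$-algebra is simple if it is nonzero and has no ideals other than $\{0\}$ and itself. The system $\Sigma$ is exact if, for every invariant ideal $J$ of $A$, the ideal $\langle J\rangle$ is the kernel of the canonical $^*$-homomorphism $C_r^*(\Sigma)\to C_r^*(\Sigma/J)$ given by $a\mapsto a+J$, $\lambda(g)\mapsto\lambda(g)$. It has property (DP) if $$0\in\overline{\mathrm{co}\{v\,y\,v^*\mid v\in\mathcal U(C_r^*(\Sigma))\}}^{\,\|\cdot\|}\quad\text{for every } y=y^*\in C_r^*(\Sigma)\text{ with }E(y)=0 .$$ **Theorem.** Assume that $\Sigma$ is exact and has property (DP). Then $J\mapsto\langle J\rangle$ is a bijection from the set of maximal invariant ideals of $A$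 onto the set of maximal ideals of $C_r^*(\Sigma)$. Moreover, the simple quotients of $C_r^*(\Sigma)$ are exactly the $C^*$-algebras $C_r^*(\Sigma/J)$ for $J$ a maximal invariant ideal of $A$. That is: 1. For every maximal invariant ideal $J$ of $A$, the algebra $C_r^*(\Sigma/J)$ is simple, and the canonical map $C_r^*(\Sigma)\to C_r^*(\Sigma/J)$ induces a $^*$-isomorphism $C_r^*(\Sigma)/\langle J\rangle\cong C_r^*(\Sigma/J)$. 2. If $\mathcal I$ is an ideal of $C_r^*(\Sigma)$ such that $C_r^*(\Sigma)/\mathcal I$ is simple, then there is a maximal invariant ideal $J$ of $A$ with $\mathcal I=\langle J\rangle$, and the canonical map induces a $^*$-isomorphism $C_r^*(\Sigma)/\mathcal I\cong C_r^*(\Sigma/J)$. -/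

import Mathlib

/-- Closed two-sided ideals of a unital C⋆-algebra (simply called ideals below). -/
structure ClosedIdeal (A : Type*) [CStarAlgebra A] where
  toIdeal : Ideal A
  isTwoSided : toIdeal.IsTwoSided
  isClosed : IsClosed (toIdeal : Set A)

namespace ClosedIdeal

section Basic
variable {A : Type*} [CStarAlgebra A]

instance : SetLike (ClosedIdeal A) A where
  coe J := (J.toIdeal : Set A)
  coe_injective := by
    rintro ⟨I, _, _⟩ ⟨J, _, _⟩ h
    have : I = J := SetLike.coe_injective h
    subst this
    rfl

instance : PartialOrder (ClosedIdeal A) := PartialOrder.lift (fun J => (J : Set A)) SetLike.coe_injective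

theorem mem_toIdeal {J : ClosedIdeal A} {a : A} : a ∈ J.toIdeal ↔ a ∈ J := Iff.rfl

theorem mul_mem_left (J : ClosedIdeal A) (a : A) {b : A} (hb : b ∈ J) : a * b ∈ J :=
  J.toIdeal.mul_mem_left a hb

theorem mul_mem_right (J : ClosedIdeal A) {a : A} (b : A) (ha : a ∈ J) : a * b ∈ J :=
  haveI := J.isTwoSided
  J.toIdeal.mul_mem_right b ha

/-- The closed two-sided ideal generated by a set. -/
def generated (S : Set A) : ClosedIdeal A where
  toIdeal := sInf {I : Ideal A | I.IsTwoSided ∧ IsClosed (I : Set A) ∧ S ⊆ I}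
  isTwoSided := ⟨fun {a} b ha => by
    rw [Submodule.mem_sInf] at ha ⊢
    intro I hI
    have := hI.1
    exact Ideal.mul_mem_right (I := I) b (ha I hI)⟩
  isClosed := by
    rw [Submodule.coe_sInf]
    exact isClosed_biInter fun I hI => hI.2.1

/-- Maximal elements among the proper closed two-sided ideals. -/
def IsMaximal (J : ClosedIdeal A) : Prop :=
  Maximal (fun K : ClosedIdeal A => (K : Set A) ≠ Set.univ) J

/-- The quotient C⋆-algebra `A/J`, with the quotient norm. -/
def Quot (J : ClosedIdeal A) : Type _ := A ⧸ J.toIdeal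
end Basic

section Quot
variable {A : Type*} [CStarAlgebra A]

open CStarAlgebra in
/-- For `j` in a closed two-sided ideal there are contractions `e` in the ideal with `j (1 - e)`
arbitrarily small. -/
theorem exists_approx (J : ClosedIdeal A) {j : A} (hj : j ∈ J) {ε : ℝ} (hε : 0 < ε) :
    ∃ e ∈ J, IsSelfAdjoint e ∧ ‖1 - e‖ ≤ 1 ∧ ‖j * (1 - e)‖ < ε := by
  let _ := CStarAlgebra.spectralOrder A
  have := CStarAlgebra.spectralOrderedRing A
  set h : A := star j * j with hh
  have hpos : 0 ≤ h := star_mul_self_nonneg j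
  have hsa : IsSelfAdjoint h := .of_nonneg hpos
  have hδ : 0 < ε ^ 2 / 2 := by positivity
  set δ := ε ^ 2 / 2 with hδdef
  have hspec : ∀ x ∈ spectrum ℝ h, 0 ≤ x := fun x hx => spectrum_nonneg_of_nonneg hpos hx
  have hc1 : ContinuousOn (fun x : ℝ => (x + δ)⁻¹) (spectrum ℝ h) := by
    apply ContinuousOn.inv₀ (by fun_prop)
    intro x hx; have := hspec x hx; positivity
  have hc2 : ContinuousOn (fun x : ℝ => δ * (x + δ)⁻¹) (spectrum ℝ h) := by fun_prop
  have hid : ContinuousOn (fun x : ℝ => x) (spectrum ℝ h) := by fun_prop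
  set e : A := cfc (fun x : ℝ => (x + δ)⁻¹) h * h with he
  have hkey : 1 - e = cfc (fun x : ℝ => δ * (x + δ)⁻¹) h := by
    have h1 : e = cfc (fun x : ℝ => (x + δ)⁻¹ * x) h := by
      rw [he, cfc_mul _ _ h hc1 hid, cfc_id' ℝ h]
    have h2 : (1 : A) = cfc (fun _ : ℝ => (1 : ℝ)) h := (cfc_const_one ℝ h).symm
    rw [h1, h2, ← cfc_sub (fun _ : ℝ => (1 : ℝ)) (fun x : ℝ => (x + δ)⁻¹ * x) h
      (by fun_prop) (hc1.mul hid)]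
    apply cfc_congr
    intro x hx
    have := hspec x hx
    have : x + δ ≠ 0 := by positivity
    field_simp
    ring
  have hsa1 : IsSelfAdjoint (1 - e) := by rw [hkey]; exact cfc_predicate _ h
  refine ⟨e, J.mul_mem_left _ (J.mul_mem_left _ hj), ?_, ?_, ?_⟩
  · have := (IsSelfAdjoint.one A).sub hsa1
    simpa using this
  · rw [hkey]
    apply norm_cfc_le zero_le_one
    intro x hx
    have := hspec x hx
    rw [Real.norm_of_nonneg (by positivity), mul_inv_le_iff₀ (by positivity)]
    linarith
  · have h2 : star (j * (1 - e)) * (j * (1 - e)) =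
        cfc (fun x : ℝ => δ * (x + δ)⁻¹ * x * (δ * (x + δ)⁻¹)) h := by
      rw [star_mul, hsa1.star_eq,
        cfc_mul (fun x : ℝ => δ * (x + δ)⁻¹ * x) (fun x : ℝ => δ * (x + δ)⁻¹) h (hc2.mul hid) hc2,
        cfc_mul (fun x : ℝ => δ * (x + δ)⁻¹) (fun x : ℝ => x) h hc2 hid,
        cfc_id' ℝ h, ← hkey, hh]
      simp only [mul_assoc]
    have h3 : ‖j * (1 - e)‖ ^ 2 ≤ δ := by
      rw [sq, ← CStarRing.norm_star_mul_self, h2]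
      apply norm_cfc_le hδ.le
      intro x hx
      have hx0 := hspec x hx
      rw [Real.norm_of_nonneg (by positivity)]
      have hxd : 0 < x + δ := by positivity
      have e1 : (x + δ)⁻¹ * (x + δ) = 1 := inv_mul_cancel₀ hxd.ne'
      have i0 : 0 < (x + δ)⁻¹ := by positivity
      have e2 : (x + δ)⁻¹ * x ≤ 1 := by nlinarith
      have e3 : δ * (x + δ)⁻¹ ≤ 1 := by nlinarith
      calc δ * (x + δ)⁻¹ * x * (δ * (x + δ)⁻¹) = δ * ((x + δ)⁻¹ * x) * (δ * (x + δ)⁻¹) := by ring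
        _ ≤ δ * 1 * 1 := by gcongr
        _ = δ := by ring
    have h4 : ‖j * (1 - e)‖ ^ 2 < ε ^ 2 := by
      have : 0 < ε ^ 2 := by positivity
      linarith
    exact lt_of_pow_lt_pow_left₀ 2 hε.le h4

theorem star_mem (J : ClosedIdeal A) {a : A} (ha : a ∈ J) : star a ∈ J := by
  have hcl : star a ∈ closure (J.toIdeal : Set A) := by
    rw [Metric.mem_closure_iff]
    intro ε hε
    obtain ⟨e, he, hsa, -, h⟩ := J.exists_approx ha hε
    refine ⟨e * star a, J.mul_mem_right _ he, ?_⟩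
    rw [dist_eq_norm, ← norm_star]
    simpa [mul_sub, hsa.star_eq] using h
  rwa [J.isClosed.closure_eq] at hcl

variable (J : ClosedIdeal A)

noncomputable instance : NormedRing J.Quot :=
  haveI := J.isTwoSided
  haveI : IsClosed (J.toIdeal : Set A) := J.isClosed
  { (Ideal.Quotient.ring J.toIdeal : Ring (A ⧸ J.toIdeal)),
    (Submodule.Quotient.normedAddCommGroup J.toIdeal : NormedAddCommGroup (A ⧸ J.toIdeal)) with
    norm_mul_le := by
      intro (x : A ⧸ J.toIdeal) (y : A ⧸ J.toIdeal)
      change ‖x * y‖ ≤ ‖x‖ * ‖y‖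
      have key : ∀ ε : ℝ, 0 < ε → ‖x * y‖ ≤ (‖x‖ + ε) * (‖y‖ + ε) := by
        intro ε hε
        obtain ⟨a, rfl, ha⟩ := Submodule.Quotient.norm_mk_lt (S := J.toIdeal) x hε
        obtain ⟨b, rfl, hb⟩ := Submodule.Quotient.norm_mk_lt (S := J.toIdeal) y hε
        calc _ ≤ ‖a * b‖ := Submodule.Quotient.norm_mk_le J.toIdeal (a * b)
          _ ≤ ‖a‖ * ‖b‖ := norm_mul_le a b
          _ ≤ _ := by gcongr
      have ht : Filter.Tendsto (fun ε : ℝ => (‖x‖ + ε) * (‖y‖ + ε)) (nhdsWithin 0 (Set.Ioi 0))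
          (nhds ((‖x‖ + 0) * (‖y‖ + 0))) :=
        (Continuous.tendsto (by fun_prop) 0).mono_left nhdsWithin_le_nhds
      have := ge_of_tendsto ht (Filter.eventually_of_mem self_mem_nhdsWithin fun ε hε => key ε hε)
      simpa using this }

noncomputable instance : NormedAlgebra ℂ J.Quot :=
  haveI := J.isTwoSided
  { (Submodule.Quotient.normedSpace J.toIdeal ℂ : NormedSpace ℂ (A ⧸ J.toIdeal)),
    (Ideal.Quotient.algebra ℂ : Algebra ℂ (A ⧸ J.toIdeal)) with }

instance : CompleteSpace J.Quot :=
  inferInstanceAs (CompleteSpace (A ⧸ J.toIdeal))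

/-- The quotient map, as a map of algebras. -/
def mkAlg : A →ₐ[ℂ] J.Quot :=
  haveI := J.isTwoSided
  Ideal.Quotient.mkₐ ℂ J.toIdeal

theorem mkAlg_surjective : Function.Surjective J.mkAlg := Submodule.Quotient.mk_surjective _

theorem mkAlg_eq_zero_iff {a : A} : J.mkAlg a = 0 ↔ a ∈ J :=
  Submodule.Quotient.mk_eq_zero J.toIdeal

theorem mkAlg_eq_iff {a b : A} : J.mkAlg a = J.mkAlg b ↔ a - b ∈ J := by
  rw [← sub_eq_zero, ← map_sub, mkAlg_eq_zero_iff]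

theorem norm_mkAlg_le (a : A) : ‖J.mkAlg a‖ ≤ ‖a‖ := Submodule.Quotient.norm_mk_le J.toIdeal a

theorem exists_norm_lt (x : J.Quot) {ε : ℝ} (hε : 0 < ε) : ∃ a, J.mkAlg a = x ∧ ‖a‖ < ‖x‖ + ε :=
  Submodule.Quotient.norm_mk_lt (S := J.toIdeal) x hε

noncomputable instance : Star J.Quot where
  star x := Quotient.liftOn' x (fun a => J.mkAlg (star a)) (by
    intro a b h
    rw [mkAlg_eq_iff, ← star_sub]
    exact J.star_mem ((Submodule.quotientRel_def J.toIdeal).1 h))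

theorem star_mkAlg (a : A) : star (J.mkAlg a) = J.mkAlg (star a) := rfl

noncomputable instance : StarRing J.Quot where
  star_involutive x := by
    obtain ⟨a, rfl⟩ := J.mkAlg_surjective x
    simp [star_mkAlg]
  star_mul x y := by
    obtain ⟨a, rfl⟩ := J.mkAlg_surjective x
    obtain ⟨b, rfl⟩ := J.mkAlg_surjective y
    simp [star_mkAlg, ← map_mul]
  star_add x y := by
    obtain ⟨a, rfl⟩ := J.mkAlg_surjective x
    obtain ⟨b, rfl⟩ := J.mkAlg_surjective y
    simp [star_mkAlg, ← map_add]

instance : StarModule ℂ J.Quot where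
  star_smul c x := by
    obtain ⟨a, rfl⟩ := J.mkAlg_surjective x
    simp [star_mkAlg, ← map_smul]

instance : CStarRing J.Quot where
  norm_mul_self_le x := by
    refine le_of_forall_pos_le_add fun ε hε => ?_
    obtain ⟨a, rfl⟩ := J.mkAlg_surjective x
    obtain ⟨b, hb, hbn⟩ := J.exists_norm_lt (star (J.mkAlg a) * J.mkAlg a) (half_pos hε)
    rw [star_mkAlg, ← map_mul, mkAlg_eq_iff] at hb
    obtain ⟨e, he, hsa, h1, h2⟩ := J.exists_approx hb (half_pos hε)
    have hsa1 : star (1 - e) = 1 - e := by simp [hsa.star_eq]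
    have hq : J.mkAlg a = J.mkAlg (a * (1 - e)) := by
      rw [mkAlg_eq_iff]
      simpa [mul_sub] using J.mul_mem_left a he
    have h3 : star (a * (1 - e)) * (a * (1 - e))
        = (1 - e) * b * (1 - e) - (1 - e) * ((b - star a * a) * (1 - e)) := by
      rw [star_mul, hsa1]; noncomm_ring
    calc ‖J.mkAlg a‖ * ‖J.mkAlg a‖ ≤ ‖a * (1 - e)‖ * ‖a * (1 - e)‖ := by
          rw [hq]; gcongr <;> exact J.norm_mkAlg_le _
      _ = ‖(1 - e) * b * (1 - e) - (1 - e) * ((b - star a * a) * (1 - e))‖ := by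
          rw [← CStarRing.norm_star_mul_self, h3]
      _ ≤ ‖(1 - e) * b * (1 - e)‖ + ‖(1 - e) * ((b - star a * a) * (1 - e))‖ := norm_sub_le _ _
      _ ≤ 1 * ‖b‖ * 1 + 1 * ‖(b - star a * a) * (1 - e)‖ := by
          gcongr
          · refine (norm_mul_le _ _).trans ?_
            gcongr
            refine (norm_mul_le _ _).trans ?_
            gcongr
          · refine (norm_mul_le _ _).trans ?_
            gcongr
      _ ≤ _ := by linarith

noncomputable instance : CStarAlgebra J.Quot where
  star_add := star_add
  norm_mul_self_le := CStarRing.norm_mul_self_le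

/-- The quotient map of a C⋆-algebra by a closed two-sided ideal. -/
def quotMap : A →⋆ₐ[ℂ] J.Quot where
  __ := J.mkAlg
  map_star' a := (J.star_mkAlg a).symm

end Quot
end ClosedIdeal

section L2
open scoped ComplexOrder InnerProductSpace
variable {I J : Type*} {E : I → Type*} {F : J → Type*}
  [∀ i, NormedAddCommGroup (E i)] [∀ i, InnerProductSpace ℂ (E i)]
  [∀ j, NormedAddCommGroup (F j)] [∀ j, InnerProductSpace ℂ (F j)]

theorem l2Map_sum_le (s : J → I) (hs : Function.Injective s) (T : ∀ j, E (s j) →L[ℂ] F j)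
    (C : ℝ) (hT : ∀ j, ‖T j‖ ≤ C) (ξ : lp E 2) (t : Finset J) :
    ∑ j ∈ t, ‖T j (ξ (s j))‖ ^ (2 : ENNReal).toReal ≤ (|C| * ‖ξ‖) ^ (2 : ENNReal).toReal := by
  classical
  have h2 : (0 : ℝ) < (2 : ENNReal).toReal := by norm_num
  calc ∑ j ∈ t, ‖T j (ξ (s j))‖ ^ (2 : ENNReal).toReal
      ≤ ∑ j ∈ t, |C| ^ (2 : ENNReal).toReal * ‖ξ (s j)‖ ^ (2 : ENNReal).toReal := by
        gcongr with j _
        rw [← Real.mul_rpow (abs_nonneg _) (norm_nonneg _)]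
        gcongr
        refine ((T j).le_opNorm _).trans ?_
        gcongr
        exact (hT j).trans (le_abs_self C)
    _ = |C| ^ (2 : ENNReal).toReal * ∑ i ∈ t.image s, ‖ξ i‖ ^ (2 : ENNReal).toReal := by
        rw [Finset.sum_image (fun _ _ _ _ h => hs h), Finset.mul_sum]
    _ ≤ |C| ^ (2 : ENNReal).toReal * ‖ξ‖ ^ (2 : ENNReal).toReal := by
        gcongr
        exact lp.sum_rpow_le_norm_rpow h2 ξ _
    _ = _ := (Real.mul_rpow (abs_nonneg _) (norm_nonneg _)).symm

/-- The bounded operator `(l2Map ξ) j = T j (ξ (s j))` between Hilbert sums, for an injective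
reindexing `s` and a uniformly bounded family `T`. -/
noncomputable def l2Map (s : J → I) (hs : Function.Injective s) (T : ∀ j, E (s j) →L[ℂ] F j)
    (C : ℝ) (hT : ∀ j, ‖T j‖ ≤ C) : lp E 2 →L[ℂ] lp F 2 :=
  LinearMap.mkContinuous
    { toFun := fun ξ => ⟨fun j => T j (ξ (s j)), memℓp_gen' (l2Map_sum_le s hs T C hT ξ)⟩
      map_add' := fun ξ η => by ext j; exact map_add (T j) _ _
      map_smul' := fun c ξ => by ext j; exact map_smul (T j) c _ }
    |C| (fun ξ => lp.norm_le_of_forall_sum_le (by norm_num) (by positivity)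
      (l2Map_sum_le s hs T C hT ξ))

theorem l2Map_apply (s : J → I) (hs : Function.Injective s) (T : ∀ j, E (s j) →L[ℂ] F j)
    (C : ℝ) (hT : ∀ j, ‖T j‖ ≤ C) (ξ : lp E 2) (j : J) :
    l2Map s hs T C hT ξ j = T j (ξ (s j)) := rfl

variable [∀ i, CompleteSpace (E i)] [∀ j, CompleteSpace (F j)]

theorem adjoint_l2Map_single [DecidableEq I] [DecidableEq J] (s : J → I) (hs : Function.Injective s)
    (T : ∀ j, E (s j) →L[ℂ] F j) (C : ℝ) (hT : ∀ j, ‖T j‖ ≤ C) (j : J) (y : F j) :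
    (l2Map s hs T C hT).adjoint (lp.single 2 j y) = lp.single 2 (s j) ((T j).adjoint y) := by
  refine ext_inner_left ℂ fun ξ => ?_
  rw [ContinuousLinearMap.adjoint_inner_right, lp.inner_single_right, lp.inner_single_right,
    ContinuousLinearMap.adjoint_inner_right, l2Map_apply]

theorem l2Map_comp_adjoint (s : J → I) (hs : Function.Injective s)
    (T : ∀ j, E (s j) →L[ℂ] F j) (C : ℝ) (hT : ∀ j, ‖T j‖ ≤ C)
    (h : ∀ j, T j ∘L (T j).adjoint = 1) :
    l2Map s hs T C hT ∘L (l2Map s hs T C hT).adjoint = 1 := by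
  classical
  have key : ∀ (j : J) (y : F j),
      l2Map s hs T C hT ((l2Map s hs T C hT).adjoint (lp.single 2 j y)) = lp.single 2 j y := by
    intro j y
    rw [adjoint_l2Map_single]
    ext k
    rw [l2Map_apply]
    by_cases hk : k = j
    · subst hk
      rw [lp.single_apply_self, lp.single_apply_self]
      exact congrArg (fun S => S y) (h k)
    · rw [lp.single_apply_ne _ _ _ (fun h' => hk (hs h')), lp.single_apply_ne _ _ _ hk, map_zero]
  ext ξ j
  refine ext_inner_left ℂ fun y => ?_
  rw [← lp.inner_single_left, ← lp.inner_single_left]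
  simp only [ContinuousLinearMap.comp_apply, one_apply_eq_self]
  rw [← ContinuousLinearMap.adjoint_inner_left, ← ContinuousLinearMap.adjoint_inner_right,
    ContinuousLinearMap.adjoint_inner_right, ContinuousLinearMap.adjoint_inner_left]
  rw [← ContinuousLinearMap.adjoint_inner_left, ← ContinuousLinearMap.adjoint_inner_left,
   ContinuousLinearMap.adjoint_adjoint, key]

theorem adjoint_l2Map_diag {E F : I → Type*}
    [∀ i, NormedAddCommGroup (E i)] [∀ i, InnerProductSpace ℂ (E i)]
    [∀ i, NormedAddCommGroup (F i)] [∀ i, InnerProductSpace ℂ (F i)]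
    [∀ i, CompleteSpace (E i)] [∀ i, CompleteSpace (F i)]
    (T : ∀ i, E i →L[ℂ] F i) (C D : ℝ) (hT : ∀ i, ‖T i‖ ≤ C) (S : ∀ i, F i →L[ℂ] E i)
    (hS : ∀ i, ‖S i‖ ≤ D) (h : ∀ i, S i = (T i).adjoint) :
    (l2Map id Function.injective_id T C hT).adjoint = l2Map id Function.injective_id S D hS := by
  symm
  rw [ContinuousLinearMap.eq_adjoint_iff]
  intro x y
  rw [lp.inner_eq_tsum, lp.inner_eq_tsum]
  congr 1
  ext i
  rw [l2Map_apply, l2Map_apply, h, ContinuousLinearMap.adjoint_inner_left]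
  rfl
end L2

section Univ
open scoped ComplexOrder InnerProductSpace
variable {A : Type*} [CStarAlgebra A] [PartialOrder A] [StarOrderedRing A]

variable (A) in
/-- The Hilbert sum of the GNS representations of all positive linear functionals of `A`. -/
noncomputable def gnsSumRep : A →⋆ₐ[ℂ]
    (lp (fun f : A →ₚ[ℂ] ℂ => f.GNS) 2 →L[ℂ] lp (fun f : A →ₚ[ℂ] ℂ => f.GNS) 2) where
  toFun a := l2Map id Function.injective_id (fun f => f.gnsStarAlgHom a) ‖a‖
    (fun f => NonUnitalStarAlgHom.norm_apply_le f.gnsStarAlgHom a)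
  map_one' := by ext ξ f; rw [l2Map_apply, map_one]; rfl
  map_mul' a b := by ext ξ f; simp only [mul_apply_eq_comp, l2Map_apply, map_mul]; rfl
  map_zero' := by ext ξ f; rw [l2Map_apply, map_zero]; rfl
  map_add' a b := by ext ξ f; simp only [add_apply, l2Map_apply, map_add]; rfl
  commutes' c := by
    ext ξ f
    simp only [l2Map_apply, AlgHomClass.commutes]
    rfl
  map_star' a := by
    rw [ContinuousLinearMap.star_eq_adjoint]
    symm
    apply adjoint_l2Map_diag
    intro f
    rw [map_star, ContinuousLinearMap.star_eq_adjoint]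

theorem exists_posFunctional {a : A} (ha : ¬ 0 ≤ a) (hsa : IsSelfAdjoint a) :
    ∃ f : A →ₚ[ℂ] ℂ, ¬ 0 ≤ f a := by
  let C : ProperCone ℝ A :=
    { carrier := {x | 0 ≤ x}
      add_mem' := fun h k => add_nonneg h k
      zero_mem' := le_refl (0 : A)
      smul_mem' := fun c x hx => smul_nonneg c.2 hx
      isClosed' := CStarAlgebra.isClosed_nonneg }
  obtain ⟨f, hf, hfa⟩ := C.hyperplane_separation_point (x₀ := a) ha
  let g : A →ₗ[ℝ] ℝ := f.toLinearMap ∘ₗ (selfAdjoint.submodule ℝ A).subtype ∘ₗ realPart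
  have hg : ∀ x : A, IsSelfAdjoint x → g x = f x := fun x hx => by
    change f ((realPart x : selfAdjoint A) : A) = f x
    rw [hx.coe_realPart]
  have hgI : ∀ x : A, IsSelfAdjoint x → g (Complex.I • x) = 0 := fun x hx => by
    change f ((realPart (Complex.I • x) : selfAdjoint A) : A) = 0
    rw [realPart_I_smul, hx.imaginaryPart]
    simp
  let F : A →ₗ[ℂ] ℂ := Module.Dual.extendRCLike (𝕜 := ℂ) g
  have hF : ∀ x : A, IsSelfAdjoint x → F x = (f x : ℂ) := fun x hx => by
    simp [F, Module.Dual.extendRCLike_apply, hg x hx, hgI x hx]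
  refine ⟨PositiveLinearMap.mk₀ F fun x hx => ?_, ?_⟩
  · rw [hF x (.of_nonneg hx)]
    exact_mod_cast hf x hx
  · change ¬ 0 ≤ F a
    rw [hF a hsa]
    exact_mod_cast not_le.2 hfa

theorem gnsSumRep_injective : Function.Injective (gnsSumRep A) := by
  classical
  rw [injective_iff_map_eq_zero]
  intro a ha
  by_contra hne
  have h1 : ¬ 0 ≤ -(star a * a) := by
    intro h
    have h2 : star a * a = 0 := le_antisymm (by simpa using h) (star_mul_self_nonneg a)
    exact hne (CStarRing.star_mul_self_eq_zero_iff a |>.1 h2)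
  obtain ⟨f, hf⟩ := exists_posFunctional h1 (IsSelfAdjoint.star_mul_self a).neg
  apply hf
  have h3 : f.gnsStarAlgHom a ((f.toPreGNS 1 : f.PreGNS) : f.GNS) = 0 := by
    have := congrArg (fun S => (S (lp.single 2 f ((f.toPreGNS 1 : f.PreGNS) : f.GNS))) f) ha
    simpa [gnsSumRep, l2Map_apply] using this
  have h4 : ((f.toPreGNS a : f.PreGNS) : f.GNS) = 0 := by
    rw [← h3, PositiveLinearMap.gnsStarAlgHom_apply]
    simp
  have h5 : ‖f.toPreGNS a‖ = 0 := by
    rw [← UniformSpace.Completion.norm_coe, h4, norm_zero]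
  have h6 := f.preGNS_norm_sq (f.toPreGNS a)
  rw [h5, PositiveLinearMap.ofPreGNS_toPreGNS] at h6
  rw [map_neg, ← h6]
  simp

variable {B : Type*} [CStarAlgebra B] [PartialOrder B] [StarOrderedRing B]

/-- The positive functional `f ∘ q`. -/
noncomputable def pullback (q : A →⋆ₐ[ℂ] B) (f : B →ₚ[ℂ] ℂ) : A →ₚ[ℂ] ℂ :=
  PositiveLinearMap.mk₀ (f.toLinearMap ∘ₗ q.toAlgHom.toLinearMap) fun x hx => by
    apply f.map_nonneg
    exact map_nonneg q hx

theorem pullback_apply (q : A →⋆ₐ[ℂ] B) (f : B →ₚ[ℂ] ℂ) (a : A) : pullback q f a = f (q a) := rfl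

theorem pullback_injective (q : A →⋆ₐ[ℂ] B) (hq : Function.Surjective q) :
    Function.Injective (pullback q) := by
  intro f g h
  ext b
  obtain ⟨a, rfl⟩ := hq b
  exact congrArg (fun k : A →ₚ[ℂ] ℂ => k a) h

/-- The isometry between pre-GNS spaces induced by `q`. -/
noncomputable def preGNSMap (q : A →⋆ₐ[ℂ] B) (f : B →ₚ[ℂ] ℂ) :
    (pullback q f).PreGNS →ₗᵢ[ℂ] f.PreGNS where
  toLinearMap := f.toPreGNS.toLinearMap ∘ₗ q.toAlgHom.toLinearMap ∘ₗ
    (pullback q f).ofPreGNS.toLinearMap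
  norm_map' x := by
    rw [PositiveLinearMap.preGNS_norm_def, PositiveLinearMap.preGNS_norm_def]
    rw [pullback_apply, map_mul q, map_star q]
    rfl

/-- The isometry `GNS (f ∘ q) → GNS f` induced by `q`. -/
noncomputable def gnsMap (q : A →⋆ₐ[ℂ] B) (f : B →ₚ[ℂ] ℂ) : (pullback q f).GNS →L[ℂ] f.GNS :=
  (preGNSMap q f).toContinuousLinearMap.completion

theorem gnsMap_coe (q : A →⋆ₐ[ℂ] B) (f : B →ₚ[ℂ] ℂ) (x : (pullback q f).PreGNS) :
    gnsMap q f x = (preGNSMap q f x : f.GNS) :=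
  ContinuousLinearMap.completion_apply_coe _ _

theorem norm_gnsMap (q : A →⋆ₐ[ℂ] B) (f : B →ₚ[ℂ] ℂ) (x : (pullback q f).GNS) :
    ‖gnsMap q f x‖ = ‖x‖ := by
  induction x using UniformSpace.Completion.induction_on with
  | hp => apply isClosed_eq <;> fun_prop
  | ih x => rw [gnsMap_coe, UniformSpace.Completion.norm_coe, UniformSpace.Completion.norm_coe,
      LinearIsometry.norm_map]

theorem gnsMap_comp_adjoint (q : A →⋆ₐ[ℂ] B) (hq : Function.Surjective q) (f : B →ₚ[ℂ] ℂ) :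
    gnsMap q f ∘L (gnsMap q f).adjoint = 1 := by
  have h1 : (gnsMap q f).adjoint ∘L gnsMap q f = 1 :=
    (ContinuousLinearMap.norm_map_iff_adjoint_comp_self _).1 (norm_gnsMap q f)
  ext y
  induction y using UniformSpace.Completion.induction_on with
  | hp => apply isClosed_eq <;> fun_prop
  | ih y =>
    obtain ⟨a, ha⟩ := hq (f.ofPreGNS y)
    have : (y : f.GNS) = gnsMap q f ((pullback q f).toPreGNS a : (pullback q f).PreGNS) := by
      rw [gnsMap_coe]
      congr 1
      change y = f.toPreGNS (q a)
      rw [ha]; rfl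
    rw [this]
    change gnsMap q f (((gnsMap q f).adjoint ∘L gnsMap q f) _) = _
    rw [h1]; rfl

theorem gnsMap_intertwine (q : A →⋆ₐ[ℂ] B) (f : B →ₚ[ℂ] ℂ) (a : A) (x : (pullback q f).GNS) :
    gnsMap q f ((pullback q f).gnsStarAlgHom a x) = f.gnsStarAlgHom (q a) (gnsMap q f x) := by
  induction x using UniformSpace.Completion.induction_on with
  | hp => apply isClosed_eq <;> fun_prop
  | ih x =>
    change gnsMap q f ((pullback q f).gnsNonUnitalStarAlgHom a x) =
      f.gnsNonUnitalStarAlgHom (q a) (gnsMap q f x)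
    rw [gnsMap_coe,
      PositiveLinearMap.gnsNonUnitalStarAlgHom_apply_coe,
      PositiveLinearMap.gnsNonUnitalStarAlgHom_apply_coe, gnsMap_coe]
    congr 1
    change f.toPreGNS (q (a * _)) = f.toPreGNS (q a * _)
    rw [map_mul]; rfl

/-- The coisometry between the sums of GNS spaces induced by a surjection `q`. -/
noncomputable def gnsSumMap (q : A →⋆ₐ[ℂ] B) (hq : Function.Surjective q) :
    lp (fun f : A →ₚ[ℂ] ℂ => f.GNS) 2 →L[ℂ] lp (fun f : B →ₚ[ℂ] ℂ => f.GNS) 2 :=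
  l2Map (pullback q) (pullback_injective q hq) (gnsMap q) 1
    (fun f => ContinuousLinearMap.opNorm_le_bound _ zero_le_one fun x => by
      rw [norm_gnsMap, one_mul])

theorem gnsSumMap_comp_adjoint (q : A →⋆ₐ[ℂ] B) (hq : Function.Surjective q) :
    gnsSumMap q hq ∘L (gnsSumMap q hq).adjoint = 1 :=
  l2Map_comp_adjoint _ _ _ _ _ (gnsMap_comp_adjoint q hq)

theorem gnsSumMap_intertwine (q : A →⋆ₐ[ℂ] B) (hq : Function.Surjective q) (a : A) :
    gnsSumMap q hq ∘L gnsSumRep A a = gnsSumRep B (q a) ∘L gnsSumMap q hq := by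
  ext ξ f
  exact gnsMap_intertwine q f a _

variable (A) in
/-- The Hilbert sum of the GNS spaces of all positive linear functionals. -/
def GnsSum : Type _ := lp (fun f : A →ₚ[ℂ] ℂ => f.GNS) 2

noncomputable instance : NormedAddCommGroup (GnsSum A) :=
  inferInstanceAs (NormedAddCommGroup (lp (fun f : A →ₚ[ℂ] ℂ => f.GNS) 2))

noncomputable instance : InnerProductSpace ℂ (GnsSum A) :=
  inferInstanceAs (InnerProductSpace ℂ (lp (fun f : A →ₚ[ℂ] ℂ => f.GNS) 2))

instance : CompleteSpace (GnsSum A) :=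
  inferInstanceAs (CompleteSpace (lp (fun f : A →ₚ[ℂ] ℂ => f.GNS) 2))

variable (A) in
/-- `gnsSumRep`, with values in the operators on `GnsSum A`. -/
noncomputable def gnsSumHom : A →⋆ₐ[ℂ] (GnsSum A →L[ℂ] GnsSum A) := gnsSumRep A

theorem gnsSumHom_injective : Function.Injective (gnsSumHom A) := gnsSumRep_injective

theorem exists_gnsSumMap (q : A →⋆ₐ[ℂ] B) (hq : Function.Surjective q) :
    ∃ V : GnsSum A →L[ℂ] GnsSum B, V ∘L V.adjoint = 1 ∧
      ∀ a, V ∘L gnsSumHom A a = gnsSumHom B (q a) ∘L V :=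
  ⟨gnsSumMap q hq, gnsSumMap_comp_adjoint q hq, gnsSumMap_intertwine q hq⟩

end Univ

section Wrap
variable (A : Type*) [CStarAlgebra A]

/-- The Hilbert space of the universal representation: the Hilbert sum of the GNS spaces of all
positive linear functionals, for the canonical order of the C⋆-algebra. -/
def UnivSpace : Type _ :=
  @GnsSum A _ (CStarAlgebra.spectralOrder A) (CStarAlgebra.spectralOrderedRing A)

noncomputable instance : NormedAddCommGroup (UnivSpace A) :=
  @instNormedAddCommGroupGnsSum A _ (CStarAlgebra.spectralOrder A) (CStarAlgebra.spectralOrderedRing A)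

noncomputable instance : InnerProductSpace ℂ (UnivSpace A) :=
  @instInnerProductSpaceComplexGnsSum A _ (CStarAlgebra.spectralOrder A) (CStarAlgebra.spectralOrderedRing A)

instance : CompleteSpace (UnivSpace A) :=
  @instCompleteSpaceGnsSum A _ (CStarAlgebra.spectralOrder A) (CStarAlgebra.spectralOrderedRing A)

/-- The universal representation of a C⋆-algebra, which is faithful. -/
noncomputable def univRep : A →⋆ₐ[ℂ] (UnivSpace A →L[ℂ] UnivSpace A) :=
  @gnsSumHom A _ (CStarAlgebra.spectralOrder A) (CStarAlgebra.spectralOrderedRing A)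

theorem univRep_injective : Function.Injective (univRep A) :=
  @gnsSumHom_injective A _ (CStarAlgebra.spectralOrder A) (CStarAlgebra.spectralOrderedRing A)

variable {A} {B : Type*} [CStarAlgebra B]

theorem exists_univMap (q : A →⋆ₐ[ℂ] B) (hq : Function.Surjective q) :
    ∃ V : UnivSpace A →L[ℂ] UnivSpace B, V ∘L V.adjoint = 1 ∧
      ∀ a, V ∘L univRep A a = univRep B (q a) ∘L V :=
  @exists_gnsSumMap A _ (CStarAlgebra.spectralOrder A) (CStarAlgebra.spectralOrderedRing A) B _
    (CStarAlgebra.spectralOrder B) (CStarAlgebra.spectralOrderedRing B) q hq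

end Wrap

section Conj
open scoped ComplexOrder InnerProductSpace
variable {H K : Type*} [NormedAddCommGroup H] [InnerProductSpace ℂ H] [CompleteSpace H]
  [NormedAddCommGroup K] [InnerProductSpace ℂ K] [CompleteSpace K]

theorem inner_map_map_of_unitary {u : H →L[ℂ] H} (hu : u ∈ unitary (H →L[ℂ] H)) (x y : H) :
    ⟪u x, u y⟫_ℂ = ⟪x, y⟫_ℂ := by
  have h : star u ∘L u = 1 := (Unitary.mem_iff.1 hu).1
  rw [← ContinuousLinearMap.adjoint_inner_left, ← ContinuousLinearMap.star_eq_adjoint,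
    ← ContinuousLinearMap.comp_apply, h]
  rfl

/-- `x` and `y` are intertwined by `W`, together with their adjoints. -/
def Intertwined (W : H →L[ℂ] K) (x : H →L[ℂ] H) (y : K →L[ℂ] K) : Prop :=
  W ∘L x = y ∘L W ∧ W ∘L star x = star y ∘L W

theorem Intertwined.of_unitary {W : H →L[ℂ] K} {x : H →L[ℂ] H} {y : K →L[ℂ] K}
    (hx : x ∈ unitary (H →L[ℂ] H)) (hy : y ∈ unitary (K →L[ℂ] K)) (h : W ∘L x = y ∘L W) :
    Intertwined W x y := by
  refine ⟨h, ?_⟩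
  have h1 : x ∘L star x = 1 := (Unitary.mem_iff.1 hx).2
  have h2 : star y ∘L y = 1 := (Unitary.mem_iff.1 hy).1
  calc W ∘L star x = (star y ∘L y) ∘L W ∘L star x := by rw [h2]; rfl
    _ = star y ∘L (y ∘L W) ∘L star x := rfl
    _ = star y ∘L W ∘L (x ∘L star x) := by rw [← h]; rfl
    _ = star y ∘L W := by rw [h1]; rfl

theorem exists_intertwined {W : H →L[ℂ] K} {X : Set (H →L[ℂ] H)}
    {T : StarSubalgebra ℂ (K →L[ℂ] K)} (hX : ∀ x ∈ X, ∃ y ∈ T, Intertwined W x y)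
    {x : H →L[ℂ] H} (hx : x ∈ StarAlgebra.adjoin ℂ X) : ∃ y ∈ T, Intertwined W x y := by
  induction hx using StarAlgebra.adjoin_induction with
  | mem x h => exact hX x h
  | algebraMap r =>
    refine ⟨algebraMap ℂ _ r, algebraMap_mem _ r, ?_, ?_⟩
    · ext1 ξ; simp [Algebra.algebraMap_eq_smul_one]
    · ext1 ξ; simp [Algebra.algebraMap_eq_smul_one]
  | add x x' _ _ hx hx' =>
    obtain ⟨y, hy, h1, h2⟩ := hx
    obtain ⟨y', hy', h1', h2'⟩ := hx'
    refine ⟨y + y', add_mem hy hy', ?_, ?_⟩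
    · rw [ContinuousLinearMap.comp_add, ContinuousLinearMap.add_comp, h1, h1']
    · rw [star_add, star_add, ContinuousLinearMap.comp_add, ContinuousLinearMap.add_comp, h2, h2']
  | mul x x' _ _ hx hx' =>
    obtain ⟨y, hy, h1, h2⟩ := hx
    obtain ⟨y', hy', h1', h2'⟩ := hx'
    refine ⟨y * y', mul_mem hy hy', ?_, ?_⟩
    · calc W ∘L (x * x') = (W ∘L x) ∘L x' := rfl
        _ = y ∘L (W ∘L x') := by rw [h1]; rfl
        _ = _ := by rw [h1']; rfl
    · rw [star_mul, star_mul]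
      calc W ∘L (star x' * star x) = (W ∘L star x') ∘L star x := rfl
        _ = star y' ∘L (W ∘L star x) := by rw [h2']; rfl
        _ = _ := by rw [h2]; rfl
  | star x _ hx =>
    obtain ⟨y, hy, h1, h2⟩ := hx
    exact ⟨star y, star_mem hy, h2, by rwa [star_star, star_star]⟩

variable {W : H →L[ℂ] K} (hW : W ∘L W.adjoint = 1) {X : Set (H →L[ℂ] H)}
  {T : StarSubalgebra ℂ (K →L[ℂ] K)} (hT : IsClosed (T : Set (K →L[ℂ] K)))
  (hX : ∀ x ∈ X, ∃ y ∈ T, Intertwined W x y)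

theorem conj_eq_of_intertwined (hW : W ∘L W.adjoint = 1) {x : H →L[ℂ] H} {y : K →L[ℂ] K}
    (h : W ∘L x = y ∘L W) : W ∘L x ∘L W.adjoint = y := by
  rw [← ContinuousLinearMap.comp_assoc, h, ContinuousLinearMap.comp_assoc, hW]
  rfl

theorem conjHom_mem_aux (hW : W ∘L W.adjoint = 1) (hT : IsClosed (T : Set (K →L[ℂ] K)))
    (hX : ∀ x ∈ X, ∃ y ∈ T, Intertwined W x y) {x : H →L[ℂ] H}
    (hx : x ∈ (StarAlgebra.adjoin ℂ X).topologicalClosure) : W ∘L x ∘L W.adjoint ∈ T := by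
  refine closure_minimal (t := (fun x => W ∘L x ∘L W.adjoint) ⁻¹' T) ?_
    (hT.preimage (by fun_prop)) hx
  intro x hx
  obtain ⟨y, hy, h1, -⟩ := exists_intertwined hX hx
  rwa [Set.mem_preimage, conj_eq_of_intertwined hW h1]

theorem conjHom_comm_aux (hX : ∀ x ∈ X, ∃ y ∈ T, Intertwined W x y) {x : H →L[ℂ] H}
    (hx : x ∈ (StarAlgebra.adjoin ℂ X).topologicalClosure) :
    W.adjoint ∘L W ∘L x = x ∘L W.adjoint ∘L W := by
  refine closure_minimal (t := {x | W.adjoint ∘L W ∘L x = x ∘L W.adjoint ∘L W}) ?_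
    (isClosed_eq (by fun_prop) (by fun_prop)) hx
  intro x hx
  obtain ⟨y, -, h1, h2⟩ := exists_intertwined hX hx
  have h3 := congrArg ContinuousLinearMap.adjoint h2
  rw [ContinuousLinearMap.adjoint_comp, ContinuousLinearMap.adjoint_comp,
    ContinuousLinearMap.star_eq_adjoint, ContinuousLinearMap.star_eq_adjoint,
    ContinuousLinearMap.adjoint_adjoint, ContinuousLinearMap.adjoint_adjoint] at h3
  rw [Set.mem_ofPred_eq, h1, ← ContinuousLinearMap.comp_assoc, ← h3,
    ContinuousLinearMap.comp_assoc]

theorem conjHom_mul_aux (hW : W ∘L W.adjoint = 1) {x y : H →L[ℂ] H}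
    (hy : W.adjoint ∘L W ∘L y = y ∘L W.adjoint ∘L W) :
    W ∘L (x * y) ∘L W.adjoint = (W ∘L x ∘L W.adjoint) * (W ∘L y ∘L W.adjoint) := by
  calc W ∘L (x * y) ∘L W.adjoint
      = W ∘L x ∘L y ∘L W.adjoint ∘L (W ∘L W.adjoint) := by rw [hW]; rfl
    _ = W ∘L x ∘L (y ∘L W.adjoint ∘L W) ∘L W.adjoint := rfl
    _ = _ := by rw [← hy]; rfl

theorem conjHom_star_aux (x : H →L[ℂ] H) :
    W ∘L (star x) ∘L W.adjoint = star (W ∘L x ∘L W.adjoint) := by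
  rw [ContinuousLinearMap.star_eq_adjoint, ContinuousLinearMap.star_eq_adjoint,
    ContinuousLinearMap.adjoint_comp, ContinuousLinearMap.adjoint_comp,
    ContinuousLinearMap.adjoint_adjoint, ContinuousLinearMap.comp_assoc]

/-- If every generator in `X` is intertwined by the coisometry `W` with an element of `T`, then
`x ↦ W x W*` is a ⋆-homomorphism from the C⋆-algebra generated by `X` to `T`. -/
noncomputable def conjHom : (StarAlgebra.adjoin ℂ X).topologicalClosure →⋆ₐ[ℂ] T where
  toFun x := ⟨W ∘L x.1 ∘L W.adjoint, conjHom_mem_aux hW hT hX x.2⟩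
  map_one' := Subtype.ext hW
  map_mul' x y := Subtype.ext (conjHom_mul_aux hW (conjHom_comm_aux hX y.2))
  map_zero' := Subtype.ext (by ext1 ξ; simp)
  map_add' x y := Subtype.ext (by ext1 ξ; simp)
  commutes' r := Subtype.ext (conj_eq_of_intertwined hW (by
    ext1 ξ; simp [Algebra.algebraMap_eq_smul_one]))
  map_star' x := Subtype.ext (conjHom_star_aux x.1)

theorem conjHom_eq {x : (StarAlgebra.adjoin ℂ X).topologicalClosure} {y : T}
    (h : W ∘L x.1 = y.1 ∘L W) : conjHom hW hT hX x = y :=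
  Subtype.ext (conj_eq_of_intertwined hW h)

end Conj

universe u v

/-- A twisted action of a discrete group `G` on a unital C⋆-algebra `A`, i.e. the data of a twisted
unital discrete C⋆-dynamical system `(A, G, α, σ)`. -/
structure TwistedSystem (A : Type u) (G : Type v) [CStarAlgebra A] [Group G] where
  α : G → (A ≃⋆ₐ[ℂ] A)
  σ : G → G → unitary A
  α_comp : ∀ g h a, α g (α h a) = (σ g h : A) * α (g * h) a * star (σ g h : A)
  cocycle : ∀ g h k, (σ g h : A) * (σ (g * h) k : A) = α g (σ h k : A) * (σ g (h * k) : A)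
  σ_one_right : ∀ g, σ g 1 = 1
  σ_one_left : ∀ g, σ 1 g = 1

namespace TwistedSystem

section Regular
open scoped ComplexOrder InnerProductSpace
variable {A : Type u} {G : Type v} [CStarAlgebra A] [Group G] (S : TwistedSystem A G)

theorem α_one (a : A) : S.α 1 a = a := by
  have hinj : Function.Injective (S.α 1) := EquivLike.injective (S.α 1)
  apply hinj
  rw [S.α_comp, S.σ_one_left]
  simp

variable (A G) in
/-- The Hilbert space `ℓ²(G, H)`, where `H` is the space of the universal representation. -/
abbrev HilbertSpace : Type _ := lp (fun _ : G => UnivSpace A) 2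

theorem regA_bound (a : A) (h : G) : ‖univRep A (S.α h⁻¹ a)‖ ≤ ‖a‖ :=
  (NonUnitalStarAlgHom.norm_apply_le (univRep A) _).trans
    (NonUnitalStarAlgHom.norm_apply_le (S.α h⁻¹) a)

/-- The representation `(π(a) ξ)(h) = α_{h⁻¹}(a) ξ(h)` of `A` on `ℓ²(G, H)`. -/
noncomputable def regA : A →⋆ₐ[ℂ] (HilbertSpace A G →L[ℂ] HilbertSpace A G) where
  toFun a := l2Map id Function.injective_id (fun h => univRep A (S.α h⁻¹ a)) ‖a‖ (S.regA_bound a)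
  map_one' := by ext ξ h; rw [l2Map_apply, map_one, map_one]; rfl
  map_mul' a b := by
    ext ξ h; simp only [mul_apply_eq_comp, l2Map_apply, map_mul]; rfl
  map_zero' := by ext ξ h; rw [l2Map_apply, map_zero, map_zero]; rfl
  map_add' a b := by
    ext ξ h; rw [l2Map_apply, map_add, map_add]; rfl
  commutes' c := by
    ext ξ h
    rw [l2Map_apply, Algebra.algebraMap_eq_smul_one, map_smul, map_smul, map_one, map_one]
    rfl
  map_star' a := by
    rw [ContinuousLinearMap.star_eq_adjoint]
    symm
    apply adjoint_l2Map_diag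
    intro h
    rw [map_star, map_star, ContinuousLinearMap.star_eq_adjoint]

theorem regA_apply (a : A) (ξ : HilbertSpace A G) (h : G) :
    S.regA a ξ h = univRep A (S.α h⁻¹ a) (ξ h) := rfl

theorem regG_bound (g h : G) : ‖univRep A (S.σ h⁻¹ g : A)‖ ≤ 1 := by
  have h1 := CStarRing.norm_coe_unitary_mul
    ⟨univRep A (S.σ h⁻¹ g : A), Unitary.map_mem (univRep A) (S.σ h⁻¹ g).2⟩ 1
  simp only [mul_one] at h1
  rw [h1]
  exact ContinuousLinearMap.norm_id_le

/-- The operators `(λ(g) ξ)(h) = σ(h⁻¹, g) ξ(g⁻¹ h)` on `ℓ²(G, H)`. -/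
noncomputable def regG (g : G) : HilbertSpace A G →L[ℂ] HilbertSpace A G :=
  l2Map (fun h => g⁻¹ * h) (mul_right_injective g⁻¹) (fun h => univRep A (S.σ h⁻¹ g : A)) 1
    (S.regG_bound g)

theorem regG_apply (g : G) (ξ : HilbertSpace A G) (h : G) :
    S.regG g ξ h = univRep A (S.σ h⁻¹ g : A) (ξ (g⁻¹ * h)) := rfl

theorem regG_mul_regA (g : G) (a : A) : S.regG g * S.regA a = S.regA (S.α g a) * S.regG g := by
  ext ξ h
  simp only [mul_apply_eq_comp, regG_apply, regA_apply]
  rw [← mul_apply_eq_comp, ← mul_apply_eq_comp, ← map_mul, ← map_mul, S.α_comp]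
  simp [mul_assoc]

theorem regG_mul_regG (g k : G) : S.regG g * S.regG k = S.regA (S.σ g k) * S.regG (g * k) := by
  ext ξ h
  simp only [mul_apply_eq_comp, regG_apply, regA_apply]
  rw [← mul_apply_eq_comp, ← mul_apply_eq_comp, ← map_mul, ← map_mul, ← S.cocycle]
  simp [mul_assoc]

theorem regG_one : S.regG 1 = 1 := by
  ext ξ h
  rw [regG_apply, S.σ_one_right]
  simp

theorem isUnitary_regG (g : G) : S.regG g ∈ unitary (HilbertSpace A G →L[ℂ] HilbertSpace A G) := by
  have h1 : star (S.regG g) * S.regG g = 1 := by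
    rw [ContinuousLinearMap.star_eq_adjoint]
    ext1 ξ
    refine ext_inner_right ℂ fun η => ?_
    rw [mul_apply_eq_comp, ContinuousLinearMap.adjoint_inner_left, lp.inner_eq_tsum, lp.inner_eq_tsum]
    have h0 : ∀ h, ⟪S.regG g ξ h, S.regG g η h⟫_ℂ = ⟪ξ (g⁻¹ * h), η (g⁻¹ * h)⟫_ℂ := fun h => by
      exact inner_map_map_of_unitary (Unitary.map_mem (univRep A) (S.σ h⁻¹ g).2) _ _
    exact (tsum_congr h0).trans ((Equiv.mulLeft g⁻¹).tsum_eq (fun h => ⟪ξ h, η h⟫_ℂ))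
  have h2 : S.regG g * (S.regG g⁻¹ * S.regA (star (S.σ g g⁻¹ : A))) = 1 := by
    rw [← mul_assoc, regG_mul_regG, mul_inv_cancel, regG_one, mul_one, ← map_mul]
    simp
  have h3 : star (S.regG g) = S.regG g⁻¹ * S.regA (star (S.σ g g⁻¹ : A)) := left_inv_eq_right_inv h1 h2
  exact Unitary.mem_iff.2 ⟨h1, by rw [h3, h2]⟩

theorem star_regG (g : G) : star (S.regG g) = S.regA (star (S.σ g⁻¹ g : A)) * S.regG g⁻¹ := by
  refine (left_inv_eq_right_inv ?_ (Unitary.mem_iff.1 (S.isUnitary_regG g)).2).symm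
  rw [mul_assoc, regG_mul_regG, inv_mul_cancel, regG_one, mul_one, ← map_mul]
  simp

/-- The C⋆-algebra of operators generated by `π(A)` and `λ(G)`. -/
noncomputable def reducedAlgebra : StarSubalgebra ℂ (HilbertSpace A G →L[ℂ] HilbertSpace A G) :=
  (StarAlgebra.adjoin ℂ (Set.range S.regA ∪ Set.range S.regG)).topologicalClosure

theorem isClosed_reducedAlgebra :
    IsClosed (S.reducedAlgebra : Set (HilbertSpace A G →L[ℂ] HilbertSpace A G)) :=
  StarSubalgebra.isClosed_topologicalClosure _

/-- The reduced twisted crossed product `C_r^*(Σ)`. -/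
def ReducedCrossedProduct : Type _ := S.reducedAlgebra

noncomputable instance : CStarAlgebra S.ReducedCrossedProduct :=
  haveI := S.isClosed_reducedAlgebra
  inferInstanceAs (CStarAlgebra S.reducedAlgebra)

/-- The inclusion of the reduced crossed product in the bounded operators. -/
noncomputable def incl : S.ReducedCrossedProduct →⋆ₐ[ℂ] (HilbertSpace A G →L[ℂ] HilbertSpace A G) :=
  S.reducedAlgebra.subtype

theorem regA_mem (a : A) : S.regA a ∈ S.reducedAlgebra :=
  StarSubalgebra.le_topologicalClosure _ (StarAlgebra.subset_adjoin _ _ (Or.inl ⟨a, rfl⟩))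

theorem regG_mem (g : G) : S.regG g ∈ S.reducedAlgebra :=
  StarSubalgebra.le_topologicalClosure _ (StarAlgebra.subset_adjoin _ _ (Or.inr ⟨g, rfl⟩))

/-- The embedding of `A` in the reduced crossed product. -/
noncomputable def ι : A →⋆ₐ[ℂ] S.ReducedCrossedProduct :=
  StarAlgHom.codRestrict S.regA S.reducedAlgebra S.regA_mem

/-- The canonical unitaries `λ(g)` of the reduced crossed product. -/
noncomputable def lam (g : G) : unitary S.ReducedCrossedProduct :=
  ⟨(⟨S.regG g, S.regG_mem g⟩ : S.reducedAlgebra), Unitary.mem_iff.2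
    ⟨Subtype.ext (Unitary.mem_iff.1 (S.isUnitary_regG g)).1,
     Subtype.ext (Unitary.mem_iff.1 (S.isUnitary_regG g)).2⟩⟩

theorem lam_mul_ι (g : G) (a : A) :
    (S.lam g : S.ReducedCrossedProduct) * S.ι a = S.ι (S.α g a) * S.lam g :=
  Subtype.ext (S.regG_mul_regA g a)

theorem lam_mul_lam (g h : G) :
    (S.lam g : S.ReducedCrossedProduct) * S.lam h = S.ι (S.σ g h) * S.lam (g * h) :=
  Subtype.ext (S.regG_mul_regG g h)

open Classical in
/-- The matrix coefficient of an operator on `ℓ²(G, H)` at `(e, e)`, an operator on `H`. -/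
noncomputable def compression :
    (HilbertSpace A G →L[ℂ] HilbertSpace A G) →ₗ[ℂ] (UnivSpace A →L[ℂ] UnivSpace A) where
  toFun x := lp.evalCLM ℂ (fun _ : G => UnivSpace A) 2 1 ∘L x ∘L
    lp.singleContinuousLinearMap ℂ (fun _ : G => UnivSpace A) 2 1
  map_add' x y := by ext v; simp
  map_smul' c x := by ext v; simp

open Classical in
theorem compression_apply (x : HilbertSpace A G →L[ℂ] HilbertSpace A G) (v : UnivSpace A) :
    compression x v = x (lp.single 2 1 v) 1 := rfl

theorem continuous_compression : Continuous (compression (A := A) (G := G)) := by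
  change Continuous fun x => lp.evalCLM ℂ (fun _ : G => UnivSpace A) 2 1 ∘L x ∘L _
  fun_prop

theorem mem_span_of_mem_adjoin {x : HilbertSpace A G →L[ℂ] HilbertSpace A G}
    (hx : x ∈ StarAlgebra.adjoin ℂ (Set.range S.regA ∪ Set.range S.regG)) :
    x ∈ Submodule.span ℂ (Set.range fun p : A × G => S.regA p.1 * S.regG p.2) := by
  have hgen : ∀ a g, S.regA a * S.regG g ∈
      Submodule.span ℂ (Set.range fun p : A × G => S.regA p.1 * S.regG p.2) :=
    fun a g => Submodule.subset_span ⟨(a, g), rfl⟩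
  induction hx using StarAlgebra.adjoin_induction with
  | mem x h =>
    rcases h with ⟨a, rfl⟩ | ⟨g, rfl⟩
    · simpa [regG_one] using hgen a 1
    · simpa using hgen 1 g
  | algebraMap r =>
    rw [Algebra.algebraMap_eq_smul_one]
    refine Submodule.smul_mem _ _ ?_
    simpa [regG_one] using hgen 1 1
  | add x y _ _ hx hy => exact add_mem hx hy
  | mul x y hxm hym hx hy =>
    clear hxm hym
    induction hx using Submodule.span_induction with
    | zero => simp
    | add x x' _ _ hx hx' => rw [add_mul]; exact add_mem hx hx'
    | smul c x _ hx => rw [smul_mul_assoc]; exact Submodule.smul_mem _ _ hx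
    | mem x hx =>
      obtain ⟨⟨a, g⟩, rfl⟩ := hx
      induction hy using Submodule.span_induction with
      | zero => simp
      | add x x' _ _ hx hx' => rw [mul_add]; exact add_mem hx hx'
      | smul c x _ hx => rw [mul_smul_comm]; exact Submodule.smul_mem _ _ hx
      | mem y hy =>
        obtain ⟨⟨b, h⟩, rfl⟩ := hy
        have : S.regA a * S.regG g * (S.regA b * S.regG h)
            = S.regA (a * S.α g b * S.σ g h) * S.regG (g * h) := by
          rw [mul_assoc, ← mul_assoc (S.regG g), regG_mul_regA, mul_assoc _ (S.regG g),
            regG_mul_regG, map_mul, map_mul]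
          simp only [mul_assoc]
        simpa only [this] using hgen _ _
  | star x hxm hx =>
    clear hxm
    induction hx using Submodule.span_induction with
    | zero => simp
    | add x x' _ _ hx hx' => rw [star_add]; exact add_mem hx hx'
    | smul c x _ hx => rw [star_smul]; exact Submodule.smul_mem _ _ hx
    | mem x hx =>
      obtain ⟨⟨a, g⟩, rfl⟩ := hx
      simp only [star_mul, star_regG]
      rw [← map_star, mul_assoc, regG_mul_regA, ← mul_assoc, ← map_mul]
      exact hgen _ _

theorem compression_mem_range (x : S.ReducedCrossedProduct) :
    compression (S.incl x) ∈ (univRep A).toAlgHom.toLinearMap.range := by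
  classical
  have hcl : IsClosed ((univRep A).toAlgHom.toLinearMap.range :
      Set (UnivSpace A →L[ℂ] UnivSpace A)) :=
    (NonUnitalStarAlgHom.isometry (univRep A) (univRep_injective A)).isClosedEmbedding.isClosed_range
  have hx : S.incl x ∈ closure (StarAlgebra.adjoin ℂ (Set.range S.regA ∪ Set.range S.regG) :
      Set (HilbertSpace A G →L[ℂ] HilbertSpace A G)) :=
    Subtype.property (p := fun y => y ∈ S.reducedAlgebra) x
  refine closure_minimal (t := compression ⁻¹' _) ?_ (hcl.preimage continuous_compression) hx
  intro y hy
  have hy' := S.mem_span_of_mem_adjoin hy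
  change y ∈ Submodule.comap compression (univRep A).toAlgHom.toLinearMap.range
  refine Submodule.span_le.2 ?_ hy'
  rintro _ ⟨⟨a, g⟩, rfl⟩
  by_cases hg : g = 1
  · subst hg
    refine ⟨a, ?_⟩
    ext v
    rw [compression_apply]
    simp [regG_one, regA_apply, α_one]
  · refine ⟨0, ?_⟩
    ext v
    rw [compression_apply]
    simp [regG_apply, regA_apply, Pi.single_eq_of_ne (show g⁻¹ ≠ 1 by simpa using hg)]

/-- The canonical conditional expectation `E : C_r^*(Σ) → A`: the coefficient at the identity,
read in `A` through the faithful representation. -/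
noncomputable def E : S.ReducedCrossedProduct →ₗ[ℂ] A :=
  (LinearEquiv.ofInjective (univRep A).toAlgHom.toLinearMap (univRep_injective A)).symm.toLinearMap ∘ₗ
    LinearMap.codRestrict _ (compression ∘ₗ S.incl.toAlgHom.toLinearMap) S.compression_mem_range

theorem univRep_E (x : S.ReducedCrossedProduct) : univRep A (S.E x) = compression (S.incl x) :=
  congrArg Subtype.val ((LinearEquiv.ofInjective (univRep A).toAlgHom.toLinearMap
    (univRep_injective A)).apply_symm_apply ⟨_, S.compression_mem_range x⟩)

theorem E_ι (a : A) : S.E (S.ι a) = a := by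
  classical
  apply univRep_injective A
  rw [univRep_E]
  ext v
  rw [compression_apply]
  change S.regA a _ 1 = _
  simp [regA_apply, α_one]

theorem E_ι_mul_lam (a : A) {g : G} (hg : g ≠ 1) : S.E (S.ι a * S.lam g) = 0 := by
  classical
  apply univRep_injective A
  rw [univRep_E]
  ext v
  rw [compression_apply]
  change S.regA a (S.regG g _) 1 = _
  simp [regG_apply, regA_apply, Pi.single_eq_of_ne (show g⁻¹ ≠ 1 by simpa using hg)]

end Regular

section Functorial
variable {A B : Type u} {G : Type v} [CStarAlgebra A] [CStarAlgebra B] [Group G]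
  (S : TwistedSystem A G) (S' : TwistedSystem B G)

/-- A surjective ⋆-homomorphism which carries one twisted action to another. -/
structure IsEquivariantSurjection (q : A →⋆ₐ[ℂ] B) : Prop where
  surjective : Function.Surjective q
  map_α : ∀ g a, q (S.α g a) = S'.α g (q a)
  map_σ : ∀ g h, q (S.σ g h) = S'.σ g h

variable {S S'} {q : A →⋆ₐ[ℂ] B}

theorem exists_intertwiner (hq : IsEquivariantSurjection S S' q) :
    ∃ W : HilbertSpace A G →L[ℂ] HilbertSpace B G, W ∘L W.adjoint = 1 ∧
      (∀ a, W ∘L S.regA a = S'.regA (q a) ∘L W) ∧ ∀ g, W ∘L S.regG g = S'.regG g ∘L W := by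
  obtain ⟨V, hV, hVr⟩ := exists_univMap q hq.surjective
  refine ⟨l2Map id Function.injective_id (fun _ => V) ‖V‖ (fun _ => le_rfl),
    l2Map_comp_adjoint _ _ _ _ _ (fun _ => hV), fun a => ?_, fun g => ?_⟩
  · ext1 ξ
    ext h
    change (V ∘L univRep A (S.α h⁻¹ a)) (ξ h) = univRep B (S'.α h⁻¹ (q a)) (V (ξ h))
    rw [hVr, hq.map_α]
    rfl
  · ext1 ξ
    ext h
    change (V ∘L univRep A (S.σ h⁻¹ g : A)) (ξ (g⁻¹ * h)) =
      univRep B (S'.σ h⁻¹ g : B) (V (ξ (g⁻¹ * h)))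
    rw [hVr, hq.map_σ]
    rfl

/-- A coisometry `ℓ²(G, H_A) → ℓ²(G, H_B)` intertwining the regular representations. -/
noncomputable def intertwiner (hq : IsEquivariantSurjection S S' q) :
    HilbertSpace A G →L[ℂ] HilbertSpace B G := (exists_intertwiner hq).choose

theorem intertwiner_comp_adjoint (hq : IsEquivariantSurjection S S' q) :
    intertwiner hq ∘L (intertwiner hq).adjoint = 1 :=
  (exists_intertwiner hq).choose_spec.1

theorem intertwiner_regA (hq : IsEquivariantSurjection S S' q) (a : A) :
    intertwiner hq ∘L S.regA a = S'.regA (q a) ∘L intertwiner hq :=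
  (exists_intertwiner hq).choose_spec.2.1 a

theorem intertwiner_regG (hq : IsEquivariantSurjection S S' q) (g : G) :
    intertwiner hq ∘L S.regG g = S'.regG g ∘L intertwiner hq :=
  (exists_intertwiner hq).choose_spec.2.2 g

theorem intertwiner_generators (hq : IsEquivariantSurjection S S' q) :
    ∀ x ∈ Set.range S.regA ∪ Set.range S.regG,
      ∃ y ∈ S'.reducedAlgebra, Intertwined (intertwiner hq) x y := by
  rintro _ (⟨a, rfl⟩ | ⟨g, rfl⟩)
  · refine ⟨S'.regA (q a), S'.regA_mem _, intertwiner_regA hq a, ?_⟩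
    rw [← map_star, ← map_star, ← map_star, intertwiner_regA]
  · exact ⟨S'.regG g, S'.regG_mem g, .of_unitary (S.isUnitary_regG g) (S'.isUnitary_regG g)
      (intertwiner_regG hq g)⟩

/-- The ⋆-homomorphism of reduced crossed products induced by an equivariant surjection; it is
determined by its values on the generators, computed below. -/
noncomputable def map (hq : IsEquivariantSurjection S S' q) :
    S.ReducedCrossedProduct →⋆ₐ[ℂ] S'.ReducedCrossedProduct :=
  conjHom (intertwiner_comp_adjoint hq) S'.isClosed_reducedAlgebra (intertwiner_generators hq)

theorem map_ι (hq : IsEquivariantSurjection S S' q) (a : A) : map hq (S.ι a) = S'.ι (q a) :=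
  conjHom_eq _ _ _ (intertwiner_regA hq a)

theorem map_lam (hq : IsEquivariantSurjection S S' q) (g : G) : map hq (S.lam g) = S'.lam g :=
  conjHom_eq _ _ _ (intertwiner_regG hq g)

end Functorial
end TwistedSystem

namespace ClosedIdeal

/-- An algebra homomorphism vanishing on a closed ideal factors through the quotient. -/
noncomputable def liftAlg {A B : Type*} [CStarAlgebra A] [CStarAlgebra B] (J : ClosedIdeal A)
    (φ : A →ₐ[ℂ] B) (h : ∀ a ∈ J, φ a = 0) : J.Quot →ₐ[ℂ] B :=
  haveI := J.isTwoSided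
  Ideal.Quotient.liftₐ J.toIdeal φ h

/-- A ⋆-homomorphism vanishing on a closed ideal factors through the quotient. -/
noncomputable def lift {A B : Type*} [CStarAlgebra A] [CStarAlgebra B] (J : ClosedIdeal A)
    (φ : A →⋆ₐ[ℂ] B) (h : ∀ a ∈ J, φ a = 0) : J.Quot →⋆ₐ[ℂ] B where
  __ := J.liftAlg φ.toAlgHom h
  map_star' x := by
    obtain ⟨a, rfl⟩ := J.mkAlg_surjective x
    exact map_star φ a

theorem lift_quotMap {A B : Type*} [CStarAlgebra A] [CStarAlgebra B] (J : ClosedIdeal A)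
    (φ : A →⋆ₐ[ℂ] B) (h : ∀ a ∈ J, φ a = 0) (a : A) : J.lift φ h (J.quotMap a) = φ a := rfl

theorem quotMap_surjective {A : Type*} [CStarAlgebra A] (J : ClosedIdeal A) :
    Function.Surjective J.quotMap := J.mkAlg_surjective

theorem quotMap_eq_zero_iff {A : Type*} [CStarAlgebra A] (J : ClosedIdeal A) {a : A} :
    J.quotMap a = 0 ↔ a ∈ J := J.mkAlg_eq_zero_iff

end ClosedIdeal

/-- A C⋆-algebra is simple if it is nonzero and has no closed two-sided ideals other than `0` and
itself. -/
def IsSimpleCStarAlgebra (B : Type*) [CStarAlgebra B] : Prop :=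
  Nontrivial B ∧ ∀ I : ClosedIdeal B, (I : Set B) = {0} ∨ (I : Set B) = Set.univ

namespace TwistedSystem
variable {A : Type u} {G : Type v} [CStarAlgebra A] [Group G] (S : TwistedSystem A G)

/-- Invariance of an ideal: `α_g(J) = J` for all `g`. -/
def IsInvariant (J : ClosedIdeal A) : Prop := ∀ g, S.α g '' (J : Set A) = J

variable {S} in
theorem IsInvariant.map_mem_iff {J : ClosedIdeal A} (hJ : S.IsInvariant J) (g : G) {a : A} :
    S.α g a ∈ J ↔ a ∈ J := by
  have hinj : Function.Injective (S.α g) := EquivLike.injective (S.α g)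
  have h := hinj.mem_set_image (s := (J : Set A)) (a := a)
  rw [hJ g] at h
  exact h

/-- The automorphism of `A/J` induced by `α_g`. -/
noncomputable def quotientα (J : ClosedIdeal A) (hJ : S.IsInvariant J) (g : G) :
    J.Quot ≃⋆ₐ[ℂ] J.Quot :=
  StarAlgEquiv.ofStarAlgHom
    (J.lift (J.quotMap.comp (S.α g : A →⋆ₐ[ℂ] A)) fun _ ha =>
      J.quotMap_eq_zero_iff.2 ((hJ.map_mem_iff g).2 ha))
    (J.lift (J.quotMap.comp ((S.α g).symm : A →⋆ₐ[ℂ] A)) fun a ha =>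
      J.quotMap_eq_zero_iff.2 ((hJ.map_mem_iff g).1 (by
        change S.α g ((S.α g).symm a) ∈ J
        rwa [StarAlgEquiv.apply_symm_apply])))
    (by
      ext x
      obtain ⟨a, rfl⟩ := J.quotMap_surjective x
      change J.quotMap ((S.α g).symm (S.α g a)) = J.quotMap a
      rw [StarAlgEquiv.symm_apply_apply])
    (by
      ext x
      obtain ⟨a, rfl⟩ := J.quotMap_surjective x
      change J.quotMap (S.α g ((S.α g).symm a)) = J.quotMap a
      rw [StarAlgEquiv.apply_symm_apply])

theorem quotientα_quotMap (J : ClosedIdeal A) (hJ : S.IsInvariant J) (g : G) (a : A) :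
    S.quotientα J hJ g (J.quotMap a) = J.quotMap (S.α g a) := rfl

/-- The quotient system `Σ/J = (A/J, G, α̇, σ̇)`. -/
noncomputable def quotient (J : ClosedIdeal A) (hJ : S.IsInvariant J) :
    TwistedSystem J.Quot G where
  α := S.quotientα J hJ
  σ g h := ⟨J.quotMap (S.σ g h), Unitary.map_mem J.quotMap (S.σ g h).2⟩
  α_comp g h x := by
    obtain ⟨a, rfl⟩ := J.quotMap_surjective x
    simp only [quotientα_quotMap, S.α_comp, map_mul, map_star]
  cocycle g h k := by
    simp only [quotientα_quotMap, ← map_mul, S.cocycle]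
  σ_one_right g := Subtype.ext (by simp [S.σ_one_right])
  σ_one_left g := Subtype.ext (by simp [S.σ_one_left])

theorem isEquivariantSurjection_quotMap (J : ClosedIdeal A) (hJ : S.IsInvariant J) :
    IsEquivariantSurjection S (S.quotient J hJ) J.quotMap where
  surjective := J.quotMap_surjective
  map_α _ _ := rfl
  map_σ _ _ := rfl

/-- The canonical ⋆-homomorphism `C_r^*(Σ) → C_r^*(Σ/J)`, with `a ↦ a + J` and
`λ(g) ↦ λ(g)`. -/
noncomputable def quotientHom (J : ClosedIdeal A) (hJ : S.IsInvariant J) :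
    S.ReducedCrossedProduct →⋆ₐ[ℂ] (S.quotient J hJ).ReducedCrossedProduct :=
  map (S.isEquivariantSurjection_quotMap J hJ)

/-- The induced ideal `⟨J⟩`: the closed two-sided ideal of `C_r^*(Σ)` generated by `J`. -/
noncomputable def induced (J : ClosedIdeal A) : ClosedIdeal S.ReducedCrossedProduct :=
  ClosedIdeal.generated (S.ι '' (J : Set A))

/-- `Σ` is exact: for every invariant ideal `J`, the ideal `⟨J⟩` is the kernel of the canonical
⋆-homomorphism `C_r^*(Σ) → C_r^*(Σ/J)`. -/
def IsExact : Prop :=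
  ∀ (J : ClosedIdeal A) (hJ : S.IsInvariant J),
    (S.induced J : Set S.ReducedCrossedProduct) = {x | S.quotientHom J hJ x = 0}

/-- Property (DP): `0` is in the norm closure of the convex hull of the unitary conjugates of every
self-adjoint `y` with `E(y) = 0`. -/
def HasDP : Prop :=
  ∀ y : S.ReducedCrossedProduct, star y = y → S.E y = 0 →
    (0 : S.ReducedCrossedProduct) ∈ closure (convexHull ℝ
      {z | ∃ v ∈ unitary S.ReducedCrossedProduct, z = v * y * star v})

/-- Maximal elements among the proper invariant ideals of `A`. -/
def IsMaximalInvariant (J : ClosedIdeal A) : Prop :=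
  Maximal (fun K : ClosedIdeal A => S.IsInvariant K ∧ (K : Set A) ≠ Set.univ) J

end TwistedSystem

/-! Write `⟨J⟩` for `S.induced J`. Everything rests on comparing an ideal `I` of the crossed product
with the closure of `E(I)` in `A`. Since `E` is an `A`-bimodule map and `E(λ(g) x λ(g)*) =
α_g(E(x))`, this closure is an invariant ideal of `A`.

Exactness gives `I ≤ ⟨closure E(I)⟩` (`IsExact.le_induced_expectationClosure`). Put `J = closure
E(I)`. For `x ∈ I` the element `E(x* x)` lies in `J`, so the image of `x* x` in the crossed product
of `Σ/J` has zero expectation. The expectation there is faithful, so `x` dies in the quotient, and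
by exactness `x ∈ ⟨J⟩`.

Property (DP) keeps `closure E(I)` proper when `I` is (`HasDP.expectationClosure_ne_univ`). If the
closure were `A`, some `x ∈ I` would have `E(x) = 1`, and its real part `y ∈ I` would too. Averaging
`1 - y` over unitary conjugates makes it small, while the same averages of `y` stay in `I` and are
then invertible.

So every proper ideal lies below some `⟨J⟩` with `J` proper and invariant. On invariant ideals `J ↦
⟨J⟩` is an order embedding (`induced_le_induced_iff`) that preserves properness. These facts match
the maximal elements on both sides. The statements on simple quotients follow because the canonical
map is surjective with kernel `⟨J⟩`, and an ideal with simple quotient is maximal. -/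

namespace TwistedSystem

/-! ### The conditional expectation: bimodule property, equivariance, faithfulness. -/

section Expectation
open scoped CStarAlgebra
open scoped ComplexOrder InnerProductSpace
variable {A : Type u} {G : Type v} [CStarAlgebra A] [Group G] (S : TwistedSystem A G)

theorem incl_injective : Function.Injective S.incl := Subtype.val_injective

theorem isClosedEmbedding_incl : Topology.IsClosedEmbedding S.incl :=
  (NonUnitalStarAlgHom.isometry S.incl S.incl_injective).isClosedEmbedding

variable {S} in
/-- The elements `a λ(g)` span a dense subspace of the reduced crossed product. -/
theorem ReducedCrossedProduct.induction {p : S.ReducedCrossedProduct → Prop}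
    (closed : IsClosed {x | p x}) (add : ∀ x y, p x → p y → p (x + y))
    (gen : ∀ a g, p (S.ι a * S.lam g)) (x : S.ReducedCrossedProduct) : p x := by
  have hcl : IsClosed (S.incl '' {x | p x}) := S.isClosedEmbedding_incl.isClosedMap _ closed
  have hx : S.incl x ∈ closure (StarAlgebra.adjoin ℂ (Set.range S.regA ∪ Set.range S.regG) :
      Set (HilbertSpace A G →L[ℂ] HilbertSpace A G)) :=
    Subtype.property (p := fun y => y ∈ S.reducedAlgebra) x
  have hsub : S.incl x ∈ S.incl '' {x | p x} := by
    refine closure_minimal ?_ hcl hx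
    intro y hy
    have hy' := S.mem_span_of_mem_adjoin hy
    clear hy
    -- The span is generated additively by scalar multiples of generators, and a scalar is absorbed
    -- into the coefficient `a`. Hence `p` need not be assumed stable under scalars.
    induction hy' using Submodule.closure_induction with
    | zero => exact ⟨0, by simpa using gen 0 1, map_zero _⟩
    | add y z _ _ hy hz =>
      obtain ⟨y', hy', rfl⟩ := hy
      obtain ⟨z', hz', rfl⟩ := hz
      exact ⟨y' + z', add _ _ hy' hz', map_add _ _ _⟩
    | smul_mem c y hy =>
      obtain ⟨⟨a, g⟩, rfl⟩ := hy
      refine ⟨S.ι (c • a) * S.lam g, gen _ _, ?_⟩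
      rw [map_smul, smul_mul_assoc, map_smul, map_mul]
      rfl
  obtain ⟨y, hy, hyx⟩ := hsub
  rwa [← S.incl_injective hyx]

/-- The faithful representation of `A` is isometric, so continuity may be tested after composing
with it, where `E` becomes the matrix coefficient at `(1, 1)`. -/
theorem continuous_E : Continuous S.E := by
  rw [(NonUnitalStarAlgHom.isometry (univRep A) (univRep_injective A)).isEmbedding.continuous_iff]
  have h : univRep A ∘ S.E = compression ∘ S.incl := funext S.univRep_E
  rw [h]
  exact continuous_compression.comp S.isClosedEmbedding_incl.continuous

theorem lam_one : (S.lam 1 : S.ReducedCrossedProduct) = 1 := Subtype.ext S.regG_one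

theorem E_one : S.E 1 = 1 := by rw [← map_one S.ι, E_ι]

theorem star_lam (g : G) : star (S.lam g : S.ReducedCrossedProduct) =
    S.ι (star (S.σ g⁻¹ g : A)) * S.lam g⁻¹ := Subtype.ext (S.star_regG g)

/-- By density it suffices to take `x = a λ(g)`, where left multiplication by `b` only changes the
coefficient. Together with `E_mul_ι` this makes `E(I)` a two-sided ideal. -/
theorem E_ι_mul (b : A) (x : S.ReducedCrossedProduct) : S.E (S.ι b * x) = b * S.E x := by
  have := S.continuous_E
  induction x using ReducedCrossedProduct.induction with
  | closed => exact isClosed_eq (by fun_prop) (by fun_prop)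
  | add x y hx hy => rw [mul_add, map_add, hx, hy, map_add, mul_add]
  | gen a g =>
    rw [← mul_assoc, ← map_mul]
    rcases eq_or_ne g 1 with rfl | hg
    · simp only [lam_one, mul_one, E_ι]
    · rw [E_ι_mul_lam _ _ hg, E_ι_mul_lam _ _ hg, mul_zero]

theorem E_mul_ι (x : S.ReducedCrossedProduct) (b : A) : S.E (x * S.ι b) = S.E x * b := by
  have := S.continuous_E
  induction x using ReducedCrossedProduct.induction with
  | closed => exact isClosed_eq (by fun_prop) (by fun_prop)
  | add x y hx hy => rw [add_mul, map_add, hx, hy, map_add, add_mul]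
  | gen a g =>
    -- Moving `b` past `λ(g)` turns it into `α_g(b)`. Only `g = 1` contributes, and there `α_1` is
    -- the identity.
    rw [mul_assoc, lam_mul_ι, ← mul_assoc, ← map_mul]
    rcases eq_or_ne g 1 with rfl | hg
    · simp only [lam_one, mul_one, E_ι, α_one]
    · rw [E_ι_mul_lam _ _ hg, E_ι_mul_lam _ _ hg, zero_mul]

theorem E_star (x : S.ReducedCrossedProduct) : S.E (star x) = star (S.E x) := by
  have := S.continuous_E
  induction x using ReducedCrossedProduct.induction with
  | closed => exact isClosed_eq (by fun_prop) (by fun_prop)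
  | add x y hx hy => rw [star_add, map_add, hx, hy, map_add, star_add]
  | gen a g =>
    rw [star_mul, ← map_star, E_mul_ι]
    rcases eq_or_ne g 1 with rfl | hg
    · simp [lam_one, E_ι, E_one]
    · rw [star_lam, E_ι_mul_lam _ _ (inv_ne_one.2 hg), E_ι_mul_lam _ _ hg, zero_mul, star_zero]

/-- Substitute `λ(gh) = σ(ghg⁻¹, g)* λ(ghg⁻¹) λ(g)` into `λ(g) λ(h) = σ(g, h) λ(gh)` and cancel
`λ(g)`. Conjugation thus permutes the `λ(h)` up to unitaries of `A`. -/
theorem lam_mul_lam_mul_star_lam (g h : G) :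
    (S.lam g : S.ReducedCrossedProduct) * S.lam h * star (S.lam g : S.ReducedCrossedProduct) =
      S.ι (S.σ g h * star (S.σ (g * h * g⁻¹) g : A)) * S.lam (g * h * g⁻¹) := by
  have h1 : S.ι (star (S.σ (g * h * g⁻¹) g : A)) *
      ((S.lam (g * h * g⁻¹) : S.ReducedCrossedProduct) * S.lam g) = S.lam (g * h) := by
    rw [lam_mul_lam, ← mul_assoc, ← map_mul, Unitary.coe_star_mul_self, map_one, one_mul,
      inv_mul_cancel_right]
  rw [lam_mul_lam, ← h1, map_mul]
  simp only [mul_assoc, Unitary.mul_star_self_of_mem (S.lam g).2, mul_one]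

/-- The expectation is equivariant. -/
theorem E_lam_mul_mul_star_lam (g : G) (x : S.ReducedCrossedProduct) :
    S.E (S.lam g * x * star (S.lam g : S.ReducedCrossedProduct)) = S.α g (S.E x) := by
  have := S.continuous_E
  have hα : Continuous (S.α g) := (NonUnitalStarAlgHom.isometry (S.α g)
    (EquivLike.injective (S.α g))).continuous
  induction x using ReducedCrossedProduct.induction with
  | closed => exact isClosed_eq (by fun_prop) (by fun_prop)
  | add x y hx hy => rw [mul_add, add_mul, map_add, hx, hy, map_add, map_add]
  | gen a h =>
    rw [← mul_assoc, lam_mul_ι, mul_assoc, mul_assoc, ← mul_assoc (S.lam g : S.ReducedCrossedProduct),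
      lam_mul_lam_mul_star_lam, E_ι_mul]
    -- For `h = 1` both cocycle factors are trivial by normalization. Otherwise `ghg⁻¹ ≠ 1`, so `E`
    -- kills the generator and its conjugate alike.
    rcases eq_or_ne h 1 with rfl | hh
    · simp [lam_one, E_ι, E_one, S.σ_one_left, S.σ_one_right]
    · rw [E_ι_mul_lam, E_ι_mul_lam _ _ hh, mul_zero, map_zero]
      simpa [mul_inv_eq_one] using hh

open Classical in
-- Up to a unitary on the fibre, `λ(g)` moves the fibre at `1` onto the fibre at `g`. This lets
-- faithfulness be checked on the fibre at `1` alone.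
theorem regG_single (g : G) (v : UnivSpace A) :
    S.regG g (lp.single 2 1 v) = lp.single 2 g (univRep A (S.σ g⁻¹ g : A) v) := by
  ext h
  rw [regG_apply]
  by_cases hh : h = g
  · subst hh
    rw [inv_mul_cancel, lp.single_apply_self, lp.single_apply_self]
  · rw [lp.single_apply_ne _ _ _ hh, lp.single_apply_ne, map_zero]
    rwa [ne_eq, inv_mul_eq_one, eq_comm]

open Classical in
-- For `ξ` supported at `1` with value `v`, `‖x ξ‖²` equals the inner product of `v` with `E(x* x)
-- v`.
theorem incl_apply_single_one_eq_zero {x : S.ReducedCrossedProduct} (hx : S.E (star x * x) = 0)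
    (v : UnivSpace A) : S.incl x (lp.single 2 1 v) = 0 := by
  have h := S.univRep_E (star x * x)
  rw [hx, map_zero] at h
  have h1 : compression (S.incl (star x * x)) v = 0 := by rw [← h]; rfl
  rw [compression_apply] at h1
  rw [← inner_self_eq_zero (𝕜 := ℂ), ← ContinuousLinearMap.adjoint_inner_right,
    ← ContinuousLinearMap.star_eq_adjoint, ← map_star, ← mul_apply_eq_comp, ← map_mul,
    lp.inner_single_left, h1, inner_zero_right]

/-- The expectation is faithful. -/
theorem eq_zero_of_E_star_mul_self {x : S.ReducedCrossedProduct} (hx : S.E (star x * x) = 0) :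
    x = 0 := by
  classical
  apply S.incl_injective
  rw [map_zero]
  refine lp.ext_continuousLinearMap (𝕜 := ℂ) (by simp) fun g => ?_
  ext1 w
  change S.incl x (lp.single 2 g w) = 0
  -- The hypothesis passes from `x` to `x λ(g)`: by equivariance `α_g` sends this expectation to
  -- `E(x* x) = 0`, and `α_g` is injective.
  have hE : S.E (star (x * S.lam g) * (x * S.lam g)) = 0 := by
    have h1 := S.E_lam_mul_mul_star_lam g (star (x * S.lam g) * (x * S.lam g))
    have h2 : (S.lam g : S.ReducedCrossedProduct) * (star (x * S.lam g) * (x * S.lam g)) *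
        star (S.lam g : S.ReducedCrossedProduct) = star x * x := by
      rw [star_mul]
      simp only [mul_assoc, Unitary.mul_star_self_of_mem (S.lam g).2, mul_one]
      rw [← mul_assoc, Unitary.mul_star_self_of_mem (S.lam g).2, one_mul]
    rw [h2, hx] at h1
    exact (map_eq_zero_iff (S.α g) (EquivLike.injective (S.α g))).1 h1.symm
  -- The vector at `1` is chosen so that `λ(g)` sends it to `w` at `g`; the factor `σ(g⁻¹, g)*`
  -- undoes the twist.
  have h3 := S.incl_apply_single_one_eq_zero hE (univRep A (star (S.σ g⁻¹ g : A)) w)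
  rw [map_mul, mul_apply_eq_comp] at h3
  change S.incl x (S.regG g _) = 0 at h3
  rwa [regG_single, ← mul_apply_eq_comp, ← map_mul,
    Unitary.mul_star_self_of_mem (S.σ g⁻¹ g).2, map_one] at h3

/-- The canonical map of crossed products intertwines the expectations. -/
theorem E_map {B : Type u} [CStarAlgebra B] {S : TwistedSystem A G} {S' : TwistedSystem B G}
    {q : A →⋆ₐ[ℂ] B} (hq : IsEquivariantSurjection S S' q) (x : S.ReducedCrossedProduct) :
    S'.E (map hq x) = q (S.E x) := by
  have := S.continuous_E
  have := S'.continuous_E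
  have hc : Continuous (map hq) := map_continuous (map hq)
  have hcq : Continuous q := map_continuous q
  induction x using ReducedCrossedProduct.induction with
  | closed => exact isClosed_eq (by fun_prop) (by fun_prop)
  | add x y hx hy => rw [map_add, map_add, hx, hy, map_add, map_add]
  | gen a g =>
    rw [map_mul, map_ι, map_lam]
    rcases eq_or_ne g 1 with rfl | hg
    · simp only [lam_one, mul_one, E_ι]
    · rw [E_ι_mul_lam _ _ hg, E_ι_mul_lam _ _ hg, map_zero]

end Expectation
end TwistedSystem

namespace ClosedIdeal

/-! ### Closed ideals, quotients and simplicity in general C⋆-algebras. -/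

section Lattice
open scoped CStarAlgebra
variable {A B : Type*} [CStarAlgebra A] [CStarAlgebra B]

theorem subset_generated (s : Set A) : s ⊆ (generated s : Set A) := by
  intro x hx
  change x ∈ sInf {I : Ideal A | I.IsTwoSided ∧ IsClosed (I : Set A) ∧ s ⊆ I}
  rw [Submodule.mem_sInf]
  exact fun I hI => hI.2.2 hx

theorem generated_le {s : Set A} {J : ClosedIdeal A} (h : s ⊆ J) : generated s ≤ J := by
  intro x hx
  change x ∈ sInf {I : Ideal A | I.IsTwoSided ∧ IsClosed (I : Set A) ∧ s ⊆ I} at hx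
  rw [Submodule.mem_sInf] at hx
  exact hx J.toIdeal ⟨J.isTwoSided, J.isClosed, h⟩

theorem coe_ne_univ_iff {J : ClosedIdeal A} : (J : Set A) ≠ Set.univ ↔ (1 : A) ∉ J := by
  rw [ne_eq, not_iff_not, Set.eq_univ_iff_forall]
  exact ⟨fun h => h 1, fun h x => by simpa using J.mul_mem_left x h⟩

/-- The preimage of a closed ideal under a ⋆-homomorphism. -/
def comap (φ : A →⋆ₐ[ℂ] B) (K : ClosedIdeal B) : ClosedIdeal A where
  toIdeal := K.toIdeal.comap φ
  isTwoSided := ⟨fun {a} b ha => by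
    change φ (a * b) ∈ K
    rw [map_mul]
    exact K.mul_mem_right _ ha⟩
  isClosed := K.isClosed.preimage (map_continuous φ)

theorem mem_comap {φ : A →⋆ₐ[ℂ] B} {K : ClosedIdeal B} {a : A} : a ∈ K.comap φ ↔ φ a ∈ K := Iff.rfl

/-- The kernel of a ⋆-homomorphism. -/
def ker (φ : A →⋆ₐ[ℂ] B) : ClosedIdeal A where
  toIdeal := RingHom.ker φ
  isTwoSided := inferInstance
  isClosed := isClosed_singleton.preimage (map_continuous φ)

/-- A closed ideal with simple quotient is maximal. -/
theorem isMaximal_of_isSimple_quot {I : ClosedIdeal A} (h : IsSimpleCStarAlgebra I.Quot) :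
    I.IsMaximal := by
  obtain ⟨hnt, hs⟩ := h
  refine ⟨coe_ne_univ_iff.2 fun h1 => ?_, fun K hK hIK => ?_⟩
  · rw [← I.quotMap_eq_zero_iff, map_one] at h1
    exact one_ne_zero h1
  · have hv : ∀ a ∈ I, K.quotMap a = 0 := fun a ha => K.quotMap_eq_zero_iff.2 (hIK ha)
    -- The image of `K` in the quotient by `I` is taken as the kernel of the induced map to the
    -- quotient by `K`, which is closed by continuity.
    rcases hs (ker (I.lift K.quotMap hv)) with h0 | h0
    · intro x hx
      have : I.quotMap x ∈ (ker (I.lift K.quotMap hv) : Set I.Quot) := by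
        change I.lift K.quotMap hv (I.quotMap x) = 0
        rw [lift_quotMap]
        exact K.quotMap_eq_zero_iff.2 hx
      rw [h0] at this
      exact I.quotMap_eq_zero_iff.1 this
    · refine absurd ?_ (coe_ne_univ_iff.1 hK)
      have : I.quotMap 1 ∈ (ker (I.lift K.quotMap hv) : Set I.Quot) := h0 ▸ Set.mem_univ _
      exact K.quotMap_eq_zero_iff.1 this

/-- The image of a ⋆-homomorphism with maximal kernel is simple. -/
theorem IsMaximal.isSimple_of_surjective {I : ClosedIdeal A} (hI : I.IsMaximal) {φ : A →⋆ₐ[ℂ] B}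
    (hφ : Function.Surjective φ) (hker : ∀ a, φ a = 0 ↔ a ∈ I) : IsSimpleCStarAlgebra B := by
  refine ⟨⟨0, 1, fun h => coe_ne_univ_iff.1 hI.prop ?_⟩, fun L => ?_⟩
  · rw [← hker, map_one, h]
  by_cases h1 : (L : Set B) = Set.univ
  · exact Or.inr h1
  left
  -- The preimage of a proper ideal `L` is proper and contains the kernel `I`, so maximality
  -- collapses it to `I`.
  have hle : L.comap φ ≤ I := by
    refine hI.le_of_ge (coe_ne_univ_iff.2 fun h => coe_ne_univ_iff.1 h1 ?_) fun a ha => ?_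
    · simpa [mem_comap] using h
    · change φ a ∈ L.toIdeal
      rw [(hker a).2 ha]
      exact zero_mem _
  ext b
  refine ⟨fun hb => ?_, fun hb => ?_⟩
  · obtain ⟨a, rfl⟩ := hφ b
    exact (hker a).2 (hle hb)
  · rw [hb]
    exact zero_mem L.toIdeal

/-- The first isomorphism theorem for ⋆-homomorphisms. -/
theorem exists_quot_equiv {I : ClosedIdeal A} {φ : A →⋆ₐ[ℂ] B}
    (hφ : Function.Surjective φ) (hker : ∀ a, φ a = 0 ↔ a ∈ I) :
    ∃ e : I.Quot ≃⋆ₐ[ℂ] B, ∀ x, e (I.quotMap x) = φ x := by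
  refine ⟨StarAlgEquiv.ofBijective (I.lift φ fun a ha => (hker a).2 ha) ⟨?_, ?_⟩, fun x => rfl⟩
  · rw [injective_iff_map_eq_zero]
    intro x hx
    obtain ⟨a, rfl⟩ := I.quotMap_surjective x
    exact I.quotMap_eq_zero_iff.2 ((hker a).1 hx)
  · intro b
    obtain ⟨a, rfl⟩ := hφ b
    exact ⟨I.quotMap a, rfl⟩

/-- After dividing by the kernel the map is injective, hence isometric, and an isometric image of a
complete space is closed. -/
theorem isClosed_range (φ : A →⋆ₐ[ℂ] B) : IsClosed (Set.range φ) := by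
  have hinj : Function.Injective ((ker φ).lift φ fun _ ha => ha) := by
    rw [injective_iff_map_eq_zero]
    intro x hx
    obtain ⟨a, rfl⟩ := (ker φ).quotMap_surjective x
    exact (ker φ).quotMap_eq_zero_iff.2 hx
  have h := (NonUnitalStarAlgHom.isometry _ hinj).isClosedEmbedding.isClosed_range
  convert h using 1
  rw [← (ker φ).quotMap_surjective.range_comp]
  rfl

/-- An ideal containing `y` is not proper if convex combinations of unitary conjugates of `1 - y`
can be made arbitrarily small. -/
theorem one_mem_of_zero_mem_closure_convexHull (I : ClosedIdeal A) {y : A} (hyI : y ∈ I)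
    (h0 : (0 : A) ∈ closure (convexHull ℝ {z | ∃ v ∈ unitary A, z = v * (1 - y) * star v})) :
    1 ∈ I := by
  -- Radius `1` is enough: `‖z‖ < 1` makes `1 - z` invertible by the Neumann series.
  obtain ⟨z, hz, hz1⟩ := Metric.mem_closure_iff.1 h0 1 one_pos
  have hconv : 1 - z ∈ I := by
    let C : Set A := {z | 1 - z ∈ I}
    have hC : Convex ℝ C := by
      intro u hu v hv s t _ _ hst
      -- Uses `s + t = 1`. Writing the real scalars as elements of the algebra lets the ideal absorb
      -- them.
      have h : 1 - (s • u + t • v) = algebraMap ℝ _ s * (1 - u) + algebraMap ℝ _ t * (1 - v) := by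
        rw [← Algebra.smul_def, ← Algebra.smul_def, smul_sub, smul_sub]
        have : (1 : A) = s • 1 + t • 1 := by rw [← add_smul, hst, one_smul]
        nth_rewrite 1 [this]
        abel
      change 1 - (s • u + t • v) ∈ I
      rw [h]
      exact I.toIdeal.add_mem (I.mul_mem_left _ hu) (I.mul_mem_left _ hv)
    refine convexHull_min ?_ hC hz
    rintro _ ⟨w, hw, rfl⟩
    -- Conjugation by a unitary fixes `1`, so what is left is a conjugate of `y`, which lies in `I`.
    have h : 1 - w * (1 - y) * star w = w * y * star w := by
      rw [mul_sub, sub_mul, mul_one, Unitary.mul_star_self_of_mem hw, sub_sub_cancel]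
    change 1 - w * (1 - y) * star w ∈ I
    rw [h]
    exact I.mul_mem_right _ (I.mul_mem_left _ hyI)
  rw [dist_zero_left] at hz1
  have hu : I.toIdeal = ⊤ := Ideal.eq_top_of_isUnit_mem _ hconv (isUnit_one_sub_of_norm_lt_one hz1)
  exact (Ideal.eq_top_iff_one _).1 hu

/-- Property (DP) concerns self-adjoint elements only, so elements of an ideal are replaced by their
real parts. -/
theorem half_add_star_mem (I : ClosedIdeal A) {x : A} (hx : x ∈ I) :
    (2⁻¹ : ℂ) • (x + star x) ∈ I := by
  rw [Algebra.smul_def]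
  exact I.mul_mem_left _ (I.toIdeal.add_mem hx (I.star_mem hx))

theorem _root_.star_half_add_star (x : A) :
    star ((2⁻¹ : ℂ) • (x + star x)) = (2⁻¹ : ℂ) • (x + star x) := by
  simp [add_comm]

end Lattice
end ClosedIdeal

/-! ### Induced ideals, and the invariant ideals obtained from the expectation. -/

namespace TwistedSystem
open scoped CStarAlgebra
variable {A : Type u} {G : Type v} [CStarAlgebra A] [Group G] (S : TwistedSystem A G)

/-- The range is closed and additive, so lifting each generator `b λ(g)` suffices. -/
theorem map_surjective {B : Type u} [CStarAlgebra B] {S : TwistedSystem A G}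
    {S' : TwistedSystem B G} {q : A →⋆ₐ[ℂ] B} (hq : IsEquivariantSurjection S S' q) :
    Function.Surjective (map hq) := fun x => by
  induction x using ReducedCrossedProduct.induction with
  | closed => exact ClosedIdeal.isClosed_range (map hq)
  | add x y hx hy =>
    obtain ⟨x, rfl⟩ := hx
    obtain ⟨y, rfl⟩ := hy
    exact ⟨x + y, map_add _ _ _⟩
  | gen b g =>
    obtain ⟨a, rfl⟩ := hq.surjective b
    exact ⟨S.ι a * S.lam g, by rw [map_mul, map_ι, map_lam]⟩

theorem ι_mem_induced {J : ClosedIdeal A} {a : A} (ha : a ∈ J) : S.ι a ∈ S.induced J :=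
  ClosedIdeal.subset_generated _ ⟨a, ha, rfl⟩

/-- The kernel is a closed ideal containing `J`. This is the half of exactness that holds for every
system. -/
theorem quotientHom_eq_zero_of_mem {J : ClosedIdeal A} (hJ : S.IsInvariant J)
    {x : S.ReducedCrossedProduct} (hx : x ∈ S.induced J) : S.quotientHom J hJ x = 0 := by
  suffices h : S.induced J ≤ ClosedIdeal.ker (S.quotientHom J hJ) from h hx
  refine ClosedIdeal.generated_le ?_
  rintro _ ⟨a, ha, rfl⟩
  change map _ (S.ι a) = 0
  rw [map_ι, J.quotMap_eq_zero_iff.2 ha, map_zero]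

/-- The expectation of the quotient system, applied to the image of `a`, returns the class of `a`
modulo `J`. Hence `⟨J⟩` meets `A` in `J`, without any exactness. -/
theorem ι_mem_induced_iff {J : ClosedIdeal A} (hJ : S.IsInvariant J) {a : A} :
    S.ι a ∈ S.induced J ↔ a ∈ J := by
  refine ⟨fun h => ?_, S.ι_mem_induced⟩
  have h1 : (S.quotient J hJ).E (S.quotientHom J hJ (S.ι a)) = J.quotMap (S.E (S.ι a)) :=
    E_map _ _
  rw [S.quotientHom_eq_zero_of_mem hJ h, map_zero, E_ι] at h1
  exact J.quotMap_eq_zero_iff.1 h1.symm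

/-- Intersecting with `A` recovers an invariant ideal from the ideal it induces. This yields
injectivity and lets maximality pass between the two sides. -/
theorem induced_le_induced_iff {J K : ClosedIdeal A} (hK : S.IsInvariant K) :
    S.induced J ≤ S.induced K ↔ J ≤ K := by
  refine ⟨fun h a ha => (S.ι_mem_induced_iff hK).1 (h (S.ι_mem_induced ha)), fun h => ?_⟩
  refine ClosedIdeal.generated_le ?_
  rintro _ ⟨a, ha, rfl⟩
  exact S.ι_mem_induced (h ha)

theorem induced_coe_ne_univ_iff {J : ClosedIdeal A} (hJ : S.IsInvariant J) :
    (S.induced J : Set S.ReducedCrossedProduct) ≠ Set.univ ↔ (J : Set A) ≠ Set.univ := by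
  rw [ClosedIdeal.coe_ne_univ_iff, ClosedIdeal.coe_ne_univ_iff, ← S.ι_mem_induced_iff hJ, map_one]

/-- The image of an ideal of the crossed product under the expectation. -/
noncomputable def expectationIdeal (I : ClosedIdeal S.ReducedCrossedProduct) : Ideal A where
  carrier := S.E '' I
  add_mem' := by
    rintro _ _ ⟨x, hx, rfl⟩ ⟨y, hy, rfl⟩
    exact ⟨x + y, I.toIdeal.add_mem hx hy, map_add _ _ _⟩
  zero_mem' := ⟨0, I.toIdeal.zero_mem, map_zero _⟩
  smul_mem' := by
    rintro a _ ⟨x, hx, rfl⟩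
    exact ⟨S.ι a * x, I.mul_mem_left _ hx, S.E_ι_mul a x⟩

/-- The closure of the image of an ideal of the crossed product under the expectation. -/
noncomputable def expectationClosure (I : ClosedIdeal S.ReducedCrossedProduct) : ClosedIdeal A where
  toIdeal := (S.expectationIdeal I).closure
  isTwoSided := ⟨fun {a} b ha => by
    refine map_mem_closure (f := fun x => x * b) (by fun_prop) ha ?_
    rintro _ ⟨x, hx, rfl⟩
    exact ⟨x * S.ι b, I.mul_mem_right _ hx, S.E_mul_ι x b⟩⟩
  isClosed := isClosed_closure

theorem coe_expectationClosure (I : ClosedIdeal S.ReducedCrossedProduct) :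
    (S.expectationClosure I : Set A) = closure (S.E '' I) := rfl

/-- Each `α_g` is isometric and onto, so it commutes with closure, and on `E(I)` it is implemented
by conjugation with `λ(g)`, which preserves `I`. -/
theorem isInvariant_expectationClosure (I : ClosedIdeal S.ReducedCrossedProduct) :
    S.IsInvariant (S.expectationClosure I) := by
  intro g
  have hα : Isometry (S.α g) := StarAlgEquiv.isometry (S.α g)
  rw [coe_expectationClosure, ← hα.isClosedEmbedding.closure_image_eq]
  congr 1
  ext a
  constructor
  · rintro ⟨_, ⟨x, hx, rfl⟩, rfl⟩
    exact ⟨_, I.mul_mem_right _ (I.mul_mem_left _ hx), S.E_lam_mul_mul_star_lam g x⟩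
  · rintro ⟨x, hx, rfl⟩
    -- The inverse conjugate of `x` serves as witness: equivariance gives `α_g(E(λ(g)* x λ(g))) =
    -- E(x)`.
    refine ⟨_, ⟨star (S.lam g : S.ReducedCrossedProduct) * x * S.lam g,
      I.mul_mem_right _ (I.mul_mem_left _ hx), rfl⟩, ?_⟩
    rw [← E_lam_mul_mul_star_lam]
    simp only [mul_assoc, Unitary.mul_star_self_of_mem (S.lam g).2, mul_one]
    rw [← mul_assoc, Unitary.mul_star_self_of_mem (S.lam g).2, one_mul]

/-! ### Consequences of (DP) and exactness; transfer of maximality. -/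

variable {S}

/-- Under property (DP), an ideal on which the expectation takes the value `1` is not proper. -/
theorem HasDP.one_mem_of_E_eq_one (hDP : S.HasDP) {I : ClosedIdeal S.ReducedCrossedProduct}
    {x : S.ReducedCrossedProduct} (hx : x ∈ I) (hE : S.E x = 1) : 1 ∈ I := by
  obtain ⟨y, hyI, hys, hyE⟩ : ∃ y ∈ I, star y = y ∧ S.E y = 1 := by
    -- Since `E` commutes with the adjoint and `1` is self-adjoint, the real part of `x` still has
    -- expectation `1`.
    refine ⟨_, I.half_add_star_mem hx, star_half_add_star x, ?_⟩
    rw [map_smul, map_add, E_star, hE, star_one, ← two_smul ℂ, smul_smul, inv_mul_cancel₀ two_ne_zero,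
      one_smul]
  have h0 := hDP (1 - y) (by rw [star_sub, star_one, hys]) (by rw [map_sub, E_one, hyE, sub_self])
  exact I.one_mem_of_zero_mem_closure_convexHull hyI h0

/-- In a Banach algebra the closure of a proper ideal is proper. So if the closure of `E(I)` were
everything, `1` would already be attained as a value `E(x)` with `x ∈ I`, not merely approximated.
-/
theorem HasDP.expectationClosure_ne_univ (hDP : S.HasDP) {I : ClosedIdeal S.ReducedCrossedProduct}
    (hI : (I : Set S.ReducedCrossedProduct) ≠ Set.univ) :
    (S.expectationClosure I : Set A) ≠ Set.univ := by
  have h : S.expectationIdeal I ≠ ⊤ := fun h => by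
    obtain ⟨x, hx, hE⟩ := (Ideal.eq_top_iff_one _).1 h
    exact ClosedIdeal.coe_ne_univ_iff.1 hI (hDP.one_mem_of_E_eq_one hx hE)
  exact fun h1 => Ideal.closure_ne_top _ h (SetLike.coe_injective h1)

theorem IsExact.quotientHom_eq_zero_iff (hexact : S.IsExact) {J : ClosedIdeal A}
    (hJ : S.IsInvariant J) (x : S.ReducedCrossedProduct) :
    S.quotientHom J hJ x = 0 ↔ x ∈ S.induced J :=
  (Set.ext_iff.1 (hexact J hJ) x).symm

/-- Faithfulness is used for the expectation of the quotient system: the image of `x* x` has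
expectation equal to the class of `E(x* x)`, which vanishes because `x* x ∈ I`. -/
theorem IsExact.le_induced_expectationClosure (hexact : S.IsExact)
    (I : ClosedIdeal S.ReducedCrossedProduct) : I ≤ S.induced (S.expectationClosure I) := by
  intro x hx
  refine (hexact.quotientHom_eq_zero_iff (S.isInvariant_expectationClosure I) x).1 ?_
  apply eq_zero_of_E_star_mul_self
  rw [← map_star, ← map_mul]
  refine (E_map _ _).trans ((ClosedIdeal.quotMap_eq_zero_iff _).2 ?_)
  exact subset_closure ⟨_, I.mul_mem_left _ hx, rfl⟩

/-- Every proper ideal is contained in the ideal induced by a proper invariant ideal. -/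
theorem exists_le_induced (hexact : S.IsExact) (hDP : S.HasDP)
    {I : ClosedIdeal S.ReducedCrossedProduct} (hI : (I : Set S.ReducedCrossedProduct) ≠ Set.univ) :
    ∃ J : ClosedIdeal A, S.IsInvariant J ∧ (J : Set A) ≠ Set.univ ∧ I ≤ S.induced J :=
  ⟨_, S.isInvariant_expectationClosure I, hDP.expectationClosure_ne_univ hI,
    hexact.le_induced_expectationClosure I⟩

/-- A proper `I` above `⟨J⟩` lies below some `⟨K⟩` with `K` proper and invariant. Then `J ≤ K`, so
maximality gives `K ≤ J` and `I` is squeezed back into `⟨J⟩`. -/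
theorem IsMaximalInvariant.isMaximal_induced (hexact : S.IsExact) (hDP : S.HasDP)
    {J : ClosedIdeal A} (hJ : S.IsMaximalInvariant J) : (S.induced J).IsMaximal := by
  refine ⟨(S.induced_coe_ne_univ_iff hJ.prop.1).2 hJ.prop.2, fun I hI hle => ?_⟩
  obtain ⟨K, hK, hK1, hIK⟩ := exists_le_induced hexact hDP hI
  have hJK := (S.induced_le_induced_iff hK).1 (hle.trans hIK)
  exact hIK.trans ((S.induced_le_induced_iff hJ.prop.1).2 (hJ.le_of_ge ⟨hK, hK1⟩ hJK))

/-- Maximality turns `I ≤ ⟨J⟩` into equality. A proper invariant ideal strictly above `J` would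
induce a proper ideal strictly above `I`. -/
theorem exists_eq_induced_of_isMaximal (hexact : S.IsExact) (hDP : S.HasDP)
    {I : ClosedIdeal S.ReducedCrossedProduct} (hI : I.IsMaximal) :
    ∃ J, S.IsMaximalInvariant J ∧ I = S.induced J := by
  obtain ⟨J, hJ, hJ1, hle⟩ := exists_le_induced hexact hDP hI.prop
  have heq := hI.eq_of_le ((S.induced_coe_ne_univ_iff hJ).2 hJ1) hle
  refine ⟨J, ⟨⟨hJ, hJ1⟩, fun K hK hJK => ?_⟩, heq⟩
  rw [heq] at hI
  exact (S.induced_le_induced_iff hJ).1 (hI.le_of_ge ((S.induced_coe_ne_univ_iff hK.1).2 hK.2)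
    ((S.induced_le_induced_iff hK.1).2 hJK))

theorem IsExact.exists_quot_equiv (hexact : S.IsExact) {J : ClosedIdeal A}
    (hJ : S.IsInvariant J) :
    ∃ e : (S.induced J).Quot ≃⋆ₐ[ℂ] (S.quotient J hJ).ReducedCrossedProduct,
      ∀ x, e ((S.induced J).quotMap x) = S.quotientHom J hJ x :=
  ClosedIdeal.exists_quot_equiv (map_surjective _) (hexact.quotientHom_eq_zero_iff hJ)

end TwistedSystem

/-! ### The bijection and the simple quotients. -/

theorem theorem3p7 {A : Type*} {G : Type*} [CStarAlgebra A] [Group G] (S : TwistedSystem A G)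
    (hexact : S.IsExact) (hDP : S.HasDP) :
    Set.BijOn S.induced {J : ClosedIdeal A | S.IsMaximalInvariant J}
      {I : ClosedIdeal S.ReducedCrossedProduct | I.IsMaximal} ∧
    (∀ (J : ClosedIdeal A) (hJ : S.IsInvariant J), S.IsMaximalInvariant J →
      IsSimpleCStarAlgebra (S.quotient J hJ).ReducedCrossedProduct ∧
      ∃ e : (S.induced J).Quot ≃⋆ₐ[ℂ] (S.quotient J hJ).ReducedCrossedProduct,
        ∀ x, e ((S.induced J).quotMap x) = S.quotientHom J hJ x) ∧
    (∀ I : ClosedIdeal S.ReducedCrossedProduct, IsSimpleCStarAlgebra I.Quot →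
      ∃ (J : ClosedIdeal A) (hJ : S.IsInvariant J), S.IsMaximalInvariant J ∧ I = S.induced J ∧
        ∃ e : I.Quot ≃⋆ₐ[ℂ] (S.quotient J hJ).ReducedCrossedProduct,
          ∀ x, e (I.quotMap x) = S.quotientHom J hJ x) := by
  refine ⟨⟨fun J hJ => hJ.isMaximal_induced hexact hDP, fun J (hJ : S.IsMaximalInvariant J) K
    (hK : S.IsMaximalInvariant K) h => ?_, fun I hI => ?_⟩,
    fun J hJ hmax => ⟨?_, hexact.exists_quot_equiv hJ⟩, fun I hI => ?_⟩
  · exact le_antisymm ((S.induced_le_induced_iff hK.prop.1).1 h.le)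
      ((S.induced_le_induced_iff hJ.prop.1).1 h.ge)
  · obtain ⟨J, hJ, rfl⟩ := TwistedSystem.exists_eq_induced_of_isMaximal hexact hDP hI
    exact ⟨J, hJ, rfl⟩
  -- Exactness identifies the kernel of the canonical surjection with the maximal ideal `⟨J⟩`, so
  -- its target is simple.
  · exact (hmax.isMaximal_induced hexact hDP).isSimple_of_surjective (TwistedSystem.map_surjective _)
      (hexact.quotientHom_eq_zero_iff hJ)
  · obtain ⟨J, hJ, rfl⟩ := TwistedSystem.exists_eq_induced_of_isMaximal hexact hDP
      (ClosedIdeal.isMaximal_of_isSimple_quot hI)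
    exact ⟨J, hJ.prop.1, hJ, rfl, hexact.exists_quot_equiv hJ.prop.1⟩
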